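/- Notation. For a function $f:(0,\infty)\to\mathbb C$ of bounded variation on $(0,\infty)$ let $\mu_f$ (also written $df$) be the complex Borel measure on $(0,\infty)$ with $\mu_f((a,b])=f(b+)-f(a+)$ for $0<a\le b$. For $1\le p\le\infty$ and a complex Borel measure $\mu$ on $\mathbb R$ put $$\|\mu\|_p^*=\sup\Big\{\Big|\int_{\mathbb R}h\,d\mu\Big| \;:\; h\in\mathcal S(\mathbb R),\ \|\widehat h\|_{L^p(\mathbb R)}\le 1\Big\},\qquad \widehat h(y)=\int_{\mathbb R}h(x)e^{-2\pi i xy}\,dx,$$ where $\mathcal S(\mathbb R)$ is the space of complex-valued Schwartz functions, and put $$\|f\|_{V_p^*}=\int_0^\infty x^{-1/p}\,\|\chi_{(x,2x)}\mu_f\|_p^*\,dx\in[0,\infty]\qquad(1/\infty=0).$$ Theorem. Let $1<p\le\infty$. There is a constant $C=C_p<\infty$, depending only on $p$, such that the following holds. Let $f:(0,\infty)\to\mathbb C$ be of bounded variation on $(0,\infty)$ with $\lim_{t\to\infty}f(t)=0$ and $\|f\|_{V_p^*}<\infty$, and let $\gamma=0$ or $\gamma=\frac14$. Then for every $x>0$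 the transform $$\widehat f_\gamma(x)=\int_0^\infty f(t)\cos 2\pi(xt-\gamma)\,dt=\lim_{R\to\infty}\int_0^R f(t)\cos2\pi(xt-\gamma)\,dt$$ (the cosine transform for $\gamma=0$, the sine transform for $\gamma=\frac14$) exists, and $$\widehat f_\gamma(x)=\frac1{2\pi x}\,f\Big(\frac1x\Big)\sin 2\pi\gamma+\Gamma(x),\qquad x>0,$$ where $\Gamma$ is Lebesgue integrable on $(0,\infty)$ and $\|\Gamma\|_{L^1(0,\infty)}\le C\,\|f\|_{V_p^*}$. No absolute continuity of $f$ is assumed. -/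

import Mathlib

open Set Filter Topology MeasureTheory
open scoped ENNReal NNReal SchwartzMap FourierTransform

/-- If `f` has bounded variation on the open half-line `(0, ∞)`, then its extension by zero to `ℝ`
has bounded variation on `ℝ`. -/
theorem BoundedVariationOn.indicator_Ioi_zero {f : ℝ → ℂ} (hf : BoundedVariationOn f (Ioi 0)) :
    BoundedVariationOn ((Ioi (0 : ℝ)).indicator f) univ := by
  have hg : BoundedVariationOn ((Ioi (0 : ℝ)).indicator f) (Ioi 0) := by
    have h : eVariationOn ((Ioi (0 : ℝ)).indicator f) (Ioi 0) = eVariationOn f (Ioi 0) :=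
      eVariationOn.congr (fun x hx => indicator_of_mem hx f)
    unfold BoundedVariationOn
    rw [h]
    exact hf
  obtain ⟨l, hl⟩ := hg.exists_tendsto_right (x := 0)
  have h1 : eVariationOn ((Ioi (0 : ℝ)).indicator f) (Iic 0) = 0 := by
    apply eVariationOn.constant_on
    rintro _ ⟨x, hx, rfl⟩ _ ⟨y, hy, rfl⟩
    rw [indicator_of_notMem (by simpa using hx), indicator_of_notMem (by simpa using hy)]
  have h2 := eVariationOn.eVariationOn_on_inter_Ici_eq_Ioi_add_edist
    (f := (Ioi (0 : ℝ)).indicator f) (s := univ) (a := 0) (l := l)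
    (by rw [univ_inter]; infer_instance) (mem_univ _) (by simpa using hl)
  rw [univ_inter, univ_inter] at h2
  unfold BoundedVariationOn
  rw [← Iic_union_Ici (a := (0 : ℝ)), eVariationOn.union _ isGreatest_Iic isLeast_Ici, h1, h2,
    zero_add]
  exact ENNReal.add_ne_top.2 ⟨hg, edist_ne_top _ _⟩

/-- The complex Borel measure `μ_f = df` on `(0, ∞)` generated by a function `f` of bounded
variation on `(0, ∞)`: it gives the mass `f(b+) - f(a+)` to `(a, b]` for `0 < a ≤ b`, and no mass
to `(-∞, 0]`. -/
noncomputable def bvMeasure {f : ℝ → ℂ} (hf : BoundedVariationOn f (Ioi 0)) : ComplexMeasure ℝ :=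
  VectorMeasure.restrict (BoundedVariationOn.vectorMeasure hf.indicator_Ioi_zero) (Ioi 0)

/-- The functional `‖μ‖_p^* = sup |∫ h dμ|`, the supremum being over the functions `h` in the unit
ball of `L̂^{p'}`, whose norm is `‖h‖_{L̂^{p'}} = ‖ĥ‖_p` (`p'` the conjugate exponent of `p`).
As `μ` may be singular, `h` has to be defined at each point and not only almost everywhere; it runs
over the Schwartz functions, which are dense in `L̂^{p'}`. The Fourier transform is
`ĥ(y) = ∫ h(x) e^{-2πixy} dx`. -/
noncomputable def starNorm (p : ℝ≥0∞) (μ : ComplexMeasure ℝ) : ℝ≥0∞ :=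
  ⨆ (h : 𝓢(ℝ, ℂ)) (_ : eLpNorm (fun y : ℝ => 𝓕 (fun x : ℝ => h x) y) p volume ≤ 1),
    ‖∫ᵛ t, h t ∂[ContinuousLinearMap.mul ℝ ℂ; μ]‖ₑ

/-- `‖f‖_{V_p^*} = ∫_0^∞ x^{-1/p} ‖χ_{(x,2x)} μ_f‖_p^* dx`, with `1/∞ = 0`. -/
noncomputable def vStarNorm (p : ℝ≥0∞) {f : ℝ → ℂ} (hf : BoundedVariationOn f (Ioi 0)) : ℝ≥0∞ :=
  ∫⁻ x in Ioi (0 : ℝ), ENNReal.ofReal (x ^ (-(p⁻¹).toReal)) *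
    starNorm p (VectorMeasure.restrict (bvMeasure hf) (Ioo x (2 * x)))

/-- `F` is the transform `f̂_γ(x) = ∫_0^∞ f(t) cos 2π(xt - γ) dt`, `x > 0`, of `f`, the integral
being improper at infinity (`γ = 0`: cosine transform, `γ = 1/4`: sine transform). -/
def IsTrigTransform (γ : ℝ) (f F : ℝ → ℂ) : Prop :=
  ∀ x : ℝ, 0 < x →
    (∀ R : ℝ, 0 < R → IntegrableOn
      (fun t => f t * (Real.cos (2 * Real.pi * (x * t - γ)) : ℂ)) (Ioc 0 R) volume) ∧
    Tendsto (fun R : ℝ => ∫ t in Ioc 0 R, f t * (Real.cos (2 * Real.pi * (x * t - γ)) : ℂ))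
      atTop (𝓝 (F x))

/-!
Since `f` vanishes at infinity, `f(t) = -μ_f((t, ∞))` for almost every `t`, so by Fubini the
transform of `f` is minus `(2πx)⁻¹ ∫ (sin 2π(xs - γ) + sin 2πγ) dμ_f(s)`, and `f(1/x)` accounts for
the term `sin 2πγ` on `s > 1/x`. What is left is linear in `μ_f`, and averaging with respect to
`du / u` reduces its `L¹` bound to a measure `μ` carried by an octave `(u, 2u)`; it remains to bound
the `L¹` norm by a multiple of `u ^ (1 - 1/p) ‖μ‖_p^*`.

* For `x ≤ 1/u` the remainder is at most `3u · sup_y |μ((y, ∞))|`. The tails of `μ` are limits of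
  integrals of `μ` against smooth cut-offs, whose Fourier transforms are dominated by the octave
  weight `min(u, 1/|x|)` up to a constant.
* For `x > 1/u` only `(2πx)⁻¹ ∫ sin 2π(xs - γ) dμ(s)` survives, and the integral of the Fourier
  transform of `μ` against `1/x` is, by duality, bounded by `‖μ‖_p^*` times the `L^p` norm of the
  octave weight.

That norm is a multiple of `u ^ (1 - 1/p)`; it is finite precisely because `p > 1`.
-/

theorem withDensityᵥ_rnDeriv_of_absolutelyContinuous {α : Type*} [MeasurableSpace α]
    {c : ComplexMeasure α} {m : Measure α} [SigmaFinite m]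
    (h : c ≪ᵥ m.toENNRealVectorMeasure) : m.withDensityᵥ (c.rnDeriv m) = c := by
  have singularPart_eq_zero {s : SignedMeasure α} (hs : s ≪ᵥ m.toENNRealVectorMeasure) :
      s.singularPart m = 0 := by
    simpa [s.withDensityᵥ_rnDeriv_eq m hs] using s.singularPart_add_withDensity_rnDeriv_eq m
  obtain ⟨hre, him⟩ := (c.absolutelyContinuous_ennreal_iff _).1 h
  have : c.HaveLebesgueDecomposition m := ⟨inferInstance, inferInstance⟩
  have hc : c.singularPart m = 0 := by
    rw [ComplexMeasure.singularPart, singularPart_eq_zero hre, singularPart_eq_zero him]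
    rfl
  simpa [hc] using c.singularPart_add_withDensity_rnDeriv_eq (μ := m)

theorem exists_isFiniteMeasure_absolutelyContinuous {α : Type*} [MeasurableSpace α]
    (c : ComplexMeasure α) :
    ∃ m : Measure α, IsFiniteMeasure m ∧ c ≪ᵥ m.toENNRealVectorMeasure := by
  have (s : SignedMeasure α) : IsFiniteMeasure s.totalVariation := by
    unfold SignedMeasure.totalVariation; infer_instance
  refine ⟨c.re.totalVariation + c.im.totalVariation, inferInstance,
    (c.absolutelyContinuous_ennreal_iff _).2
      ⟨(SignedMeasure.absolutelyContinuous_ennreal_iff _ _).2 ?_,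
        (SignedMeasure.absolutelyContinuous_ennreal_iff _ _).2 ?_⟩⟩ <;>
  rw [VectorMeasure.ennrealToMeasure_toENNRealVectorMeasure]
  exacts [(Measure.le_add_right le_rfl).absolutelyContinuous,
    (Measure.le_add_left le_rfl).absolutelyContinuous]

theorem withDensityᵥ_restrict {α E : Type*} [MeasurableSpace α] [NormedAddCommGroup E]
    [NormedSpace ℝ E] {m : Measure α} {θ : α → E} (hθ : Integrable θ m) {s : Set α}
    (hs : MeasurableSet s) :
    (m.withDensityᵥ θ).restrict s = (m.restrict s).withDensityᵥ θ := by
  ext t ht : 1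
  rw [VectorMeasure.restrict_apply _ hs ht, withDensityᵥ_apply hθ (ht.inter hs),
    withDensityᵥ_apply hθ.integrableOn ht, Measure.restrict_restrict ht]

theorem exists_withDensityᵥ_eq_restrict {α : Type*} [MeasurableSpace α] (c : ComplexMeasure α)
    {s : Set α} (hs : MeasurableSet s) :
    ∃ (m : Measure α) (θ : α → ℂ), IsFiniteMeasure m ∧ (∀ᵐ x ∂m, x ∈ s) ∧ Integrable θ m ∧
      m.withDensityᵥ θ = c.restrict s := by
  obtain ⟨m, hm, hc⟩ := exists_isFiniteMeasure_absolutelyContinuous c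
  have hθ := c.integrable_rnDeriv m
  refine ⟨m.restrict s, c.rnDeriv m, inferInstance, ae_restrict_mem hs, hθ.restrict, ?_⟩
  rw [← withDensityᵥ_restrict hθ hs, withDensityᵥ_rnDeriv_of_absolutelyContinuous hc]

section IntegralWithDensity

variable {α E F G : Type*} [MeasurableSpace α] [NormedAddCommGroup E] [NormedSpace ℝ E]
  [NormedAddCommGroup F] [NormedSpace ℝ F] [CompleteSpace F] [NormedAddCommGroup G]
  [NormedSpace ℝ G] [CompleteSpace G]
  {m : Measure α} {θ : α → F} (B : E →L[ℝ] F →L[ℝ] G)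

theorem isFiniteMeasure_variation_withDensityᵥ (hθ : Integrable θ m) :
    IsFiniteMeasure (m.withDensityᵥ θ).variation := by
  rw [Measure.variation_withDensityᵥ hθ]
  exact isFiniteMeasure_withDensity hθ.2.ne

theorem integral_simpleFunc_withDensityᵥ (hθ : Integrable θ m) (g : SimpleFunc α E) :
    ∫ᵛ t, g t ∂[B; m.withDensityᵥ θ] = ∫ t, B (g t) (θ t) ∂m := by
  have := isFiniteMeasure_variation_withDensityᵥ hθ
  induction g using SimpleFunc.induction with
  | @const c s hs =>
    have coe_piecewise : (SimpleFunc.piecewise s hs (.const α c) (.const α 0) : α → E)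
        = s.indicator fun _ => c := by
      ext t; by_cases ht : t ∈ s <;> simp [ht]
    have indicator_apply : (fun t => B (s.indicator (fun _ => c) t) (θ t))
        = s.indicator fun t => B c (θ t) := by
      ext t; by_cases ht : t ∈ s <;> simp [ht]
    rw [coe_piecewise, indicator_apply, integral_indicator hs,
      (B c).integral_comp_comm hθ.integrableOn, VectorMeasure.integral_indicator_const c hs,
      withDensityᵥ_apply hθ hs]
  | @add f g _ hf hg =>
    have integrable_apply (q : SimpleFunc α E) : Integrable (fun t => B (q t) (θ t)) m := by
      obtain ⟨D, hD⟩ := q.exists_forall_norm_le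
      exact B.integrable_of_bilin_of_bdd_left D q.aestronglyMeasurable (ae_of_all _ hD) hθ
    simp only [SimpleFunc.coe_add, Pi.add_apply, map_add, add_apply]
    rw [integral_add (integrable_apply f) (integrable_apply g), ← hf, ← hg]
    exact VectorMeasure.integral_fun_add (SimpleFunc.integrable_of_isFiniteMeasure f)
      (SimpleFunc.integrable_of_isFiniteMeasure g)

theorem integral_withDensityᵥ (hθ : Integrable θ m) {h : α → E} (hh : StronglyMeasurable h)
    {C : ℝ} (hC : ∀ x, ‖h x‖ ≤ C) :
    ∫ᵛ t, h t ∂[B; m.withDensityᵥ θ] = ∫ t, B (h t) (θ t) ∂m := by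
  have := isFiniteMeasure_variation_withDensityᵥ hθ
  rcases isEmpty_or_nonempty α with _ | ⟨⟨x₀⟩⟩
  · simp [VectorMeasure.integral_of_isEmpty, Measure.eq_zero_of_isEmpty m]
  have hC₀ : 0 ≤ C := (norm_nonneg _).trans (hC x₀)
  have approx_le (n : ℕ) (x : α) := hh.norm_approxBounded_le hC₀ n x
  have tendsto_approx (x : α) := hh.tendsto_approxBounded_of_norm_le (hC x)
  have tendsto_left : Tendsto (fun n => ∫ᵛ t, hh.approxBounded C n t ∂[B; m.withDensityᵥ θ])
      atTop (𝓝 (∫ᵛ t, h t ∂[B; m.withDensityᵥ θ])) :=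
    VectorMeasure.tendsto_integral_of_dominated_convergence (fun _ => C)
      (fun n => SimpleFunc.aestronglyMeasurable _) (integrable_const _)
      (fun n => ae_of_all _ (approx_le n)) (ae_of_all _ tendsto_approx)
  have tendsto_right : Tendsto (fun n => ∫ t, B (hh.approxBounded C n t) (θ t) ∂m)
      atTop (𝓝 (∫ t, B (h t) (θ t) ∂m)) := by
    refine tendsto_integral_of_dominated_convergence (fun t => ‖B‖ * C * ‖θ t‖)
      (fun n => B.aestronglyMeasurable_comp₂ (SimpleFunc.aestronglyMeasurable _) hθ.1)
      (hθ.norm.const_mul _) (fun n => ae_of_all _ fun x => ?_) (ae_of_all _ fun x => ?_)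
    · exact (B.le_opNorm₂ _ _).trans (by gcongr; exact approx_le n x)
    · exact ((B.flip (θ x)).continuous.tendsto _).comp (tendsto_approx x)
  exact tendsto_nhds_unique tendsto_left
    (tendsto_right.congr fun n => (integral_simpleFunc_withDensityᵥ B hθ _).symm)

end IntegralWithDensity

theorem enorm_integral_le_eLpNorm_fourier_mul_starNorm {p : ℝ≥0∞} (hp : p ≠ 0)
    (μ : ComplexMeasure ℝ) (h : 𝓢(ℝ, ℂ)) :
    ‖∫ᵛ t, h t ∂[ContinuousLinearMap.mul ℝ ℂ; μ]‖ₑ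
      ≤ eLpNorm (𝓕 (h : ℝ → ℂ)) p volume * starNorm p μ := by
  set N := eLpNorm (𝓕 (h : ℝ → ℂ)) p volume
  have fourier_memLp : MemLp (𝓕 (h : ℝ → ℂ)) p volume := by
    rw [← SchwartzMap.fourier_coe]
    exact (𝓕 h).memLp p volume
  rcases eq_or_ne N 0 with hN0 | hN0
  · have fourier_eq_zero : 𝓕 h = 0 := by
      refine DFunLike.coe_injective (Continuous.ae_eq_iff_eq volume (𝓕 h).continuous
        continuous_zero |>.1 ?_)
      rw [SchwartzMap.fourier_coe]
      exact (eLpNorm_eq_zero_iff fourier_memLp.1 hp).1 hN0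
    have : h = 0 := by simpa using congrArg 𝓕⁻ fourier_eq_zero
    simp [this]
  · have hNtop : N ≠ ∞ := fourier_memLp.2.ne
    set c : ℝ := N.toReal⁻¹ with hc
    have enorm_c : ‖c‖ₑ = N⁻¹ := by
      rw [Real.enorm_of_nonneg (by positivity), hc,
        ENNReal.ofReal_inv_of_pos (ENNReal.toReal_pos hN0 hNtop), ENNReal.ofReal_toReal hNtop]
    have admissible : eLpNorm (fun y : ℝ => 𝓕 (fun x : ℝ => (c • h) x) y) p volume ≤ 1 := by
      have : (fun y : ℝ => 𝓕 (fun x : ℝ => (c • h) x) y) = c • 𝓕 (h : ℝ → ℂ) :=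
        VectorFourier.fourierIntegral_const_smul _ _ _ (h : ℝ → ℂ) c
      rw [this, eLpNorm_const_smul, enorm_c, ENNReal.inv_mul_cancel hN0 hNtop]
    have le_starNorm : ‖∫ᵛ t, (c • h) t ∂[ContinuousLinearMap.mul ℝ ℂ; μ]‖ₑ ≤ starNorm p μ :=
      le_iSup₂_of_le (c • h) admissible le_rfl
    calc ‖∫ᵛ t, h t ∂[ContinuousLinearMap.mul ℝ ℂ; μ]‖ₑ
        = N * ‖∫ᵛ t, (c • h) t ∂[ContinuousLinearMap.mul ℝ ℂ; μ]‖ₑ := by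
          simp only [smul_apply]
          rw [VectorMeasure.integral_fun_smul, enorm_smul, enorm_c, ← mul_assoc,
            ENNReal.mul_inv_cancel hN0 hNtop, one_mul]
      _ ≤ N * starNorm p μ := by gcongr

theorem enorm_integral_mul_le_eLpNorm_fourier_mul_starNorm {p : ℝ≥0∞} (hp : p ≠ 0)
    {m : Measure ℝ} {θ : ℝ → ℂ} (hθ : Integrable θ m) (h : 𝓢(ℝ, ℂ)) :
    ‖∫ t, h t * θ t ∂m‖ₑ
      ≤ eLpNorm (𝓕 (h : ℝ → ℂ)) p volume * starNorm p (m.withDensityᵥ θ) := by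
  have := integral_withDensityᵥ (ContinuousLinearMap.mul ℝ ℂ) hθ h.continuous.stronglyMeasurable
    h.toBoundedContinuousFunction.norm_coe_le_norm
  simp only [ContinuousLinearMap.mul_apply'] at this
  rw [← this]
  exact enorm_integral_le_eLpNorm_fourier_mul_starNorm hp _ h

theorem eLpNorm_comp_mul_left {E : Type*} [NormedAddCommGroup E] (g : ℝ → E) (p : ℝ≥0∞) {u : ℝ}
    (hu : 0 < u) :
    eLpNorm (fun x => g (u * x)) p volume
      = ENNReal.ofReal (u ^ (-(p⁻¹).toReal)) * eLpNorm g p volume := by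
  have : eLpNorm (g ∘ (u * ·)) p volume = eLpNorm g p (volume.map (u * ·)) :=
    ((Homeomorph.mulLeft₀ u hu.ne').measurableEmbedding.eLpNorm_map_measure).symm
  rw [← Function.comp_def g, this, Real.map_volume_mul_left hu.ne',
    eLpNorm_smul_measure_of_ne_zero (by simpa using hu.ne'), abs_of_pos (inv_pos.2 hu), smul_eq_mul,
    one_div, ENNReal.ofReal_rpow_of_pos (inv_pos.2 hu), Real.inv_rpow hu.le, Real.rpow_neg hu.le]

/-- The Fourier-side weight attached to the octave `(u, 2u)`, comparable to `min u |x|⁻¹`: the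
Fourier transform of a cut-off of bounded variation living on that octave is at most a multiple
of it. -/
noncomputable def octaveWeight (u x : ℝ) : ℝ := u / √(1 + (u * x) ^ 2)

theorem octaveWeight_pos {u : ℝ} (hu : 0 < u) (x : ℝ) : 0 < octaveWeight u x := by
  unfold octaveWeight; positivity

theorem octaveWeight_neg (u x : ℝ) : octaveWeight u (-x) = octaveWeight u x := by
  simp [octaveWeight]

theorem contDiff_octaveWeight (u : ℝ) {n : ℕ∞} : ContDiff ℝ n (octaveWeight u) := by
  unfold octaveWeight
  have (x : ℝ) : 0 < 1 + (u * x) ^ 2 := by positivity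
  exact contDiff_const.div (ContDiff.sqrt (by fun_prop) fun x => (this x).ne')
    fun x => (Real.sqrt_pos.2 (this x)).ne'

theorem octaveWeight_eq_mul_octaveWeight_one (u x : ℝ) :
    octaveWeight u x = u * octaveWeight 1 (u * x) := by
  simp [octaveWeight, div_eq_mul_inv]

theorem memLp_octaveWeight_one {p : ℝ≥0∞} (hp : 1 < p) : MemLp (octaveWeight 1) p volume := by
  have hmeas : AEStronglyMeasurable (octaveWeight 1) volume :=
    (contDiff_octaveWeight 1 (n := 0)).continuous.aestronglyMeasurable
  have norm_eq (x : ℝ) : ‖octaveWeight 1 x‖ = (1 + ‖x‖ ^ 2) ^ (-(1 / 2) : ℝ) := by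
    rw [Real.norm_of_nonneg (octaveWeight_pos one_pos x).le, octaveWeight, Real.rpow_neg
      (by positivity), ← Real.sqrt_eq_rpow, Real.norm_eq_abs, sq_abs, one_mul, one_div]
  rcases eq_or_ne p ∞ with rfl | htop
  · refine memLp_top_of_bound hmeas 1 (ae_of_all _ fun x => ?_)
    rw [norm_eq]
    exact Real.rpow_le_one_of_one_le_of_nonpos (by nlinarith [sq_nonneg ‖x‖]) (by norm_num)
  · rw [← integrable_norm_rpow_iff hmeas (zero_lt_one.trans hp).ne' htop]
    have one_lt : 1 < p.toReal := by simpa using ENNReal.toReal_strict_mono htop hp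
    refine (integrable_rpow_neg_one_add_norm_sq (E := ℝ) (r := p.toReal)
      (by simpa using one_lt)).congr (ae_of_all _ fun x => ?_)
    beta_reduce
    rw [norm_eq, ← Real.rpow_mul (by positivity)]
    congr 1
    ring

theorem eLpNorm_octaveWeight (p : ℝ≥0∞) {u : ℝ} (hu : 0 < u) :
    eLpNorm (octaveWeight u) p volume
      = ENNReal.ofReal (u ^ (1 - (p⁻¹).toReal)) * eLpNorm (octaveWeight 1) p volume := by
  have : octaveWeight u = u • fun x => octaveWeight 1 (u * x) := by
    ext x; exact octaveWeight_eq_mul_octaveWeight_one u x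
  rw [this, eLpNorm_const_smul, eLpNorm_comp_mul_left _ p hu, Real.enorm_of_nonneg hu.le,
    ← mul_assoc, ← ENNReal.ofReal_mul hu.le, sub_eq_add_neg, Real.rpow_add hu, Real.rpow_one]

theorem le_mul_octaveWeight {D u x a : ℝ} (hu : 0 < u) (ha : 0 ≤ a) (hau : a ≤ D * u)
    (hax : |x| * a ≤ D) : a ≤ 2 * D * octaveWeight u x := by
  have sqrt_le : √(1 + (u * x) ^ 2) ≤ 1 + u * |x| := by
    rw [Real.sqrt_le_left (by positivity)]
    rw [← sq_abs (u * x), abs_mul, abs_of_pos hu]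
    nlinarith [mul_nonneg hu.le (abs_nonneg x)]
  rw [octaveWeight, ← mul_div_assoc, le_div_iff₀ (by positivity)]
  calc a * √(1 + (u * x) ^ 2) ≤ a * (1 + u * |x|) := by gcongr
    _ = a + u * (|x| * a) := by ring
    _ ≤ D * u + u * D := by gcongr
    _ = 2 * D * u := by ring

theorem inv_two_pi_mul_le_octaveWeight {u x : ℝ} (hu : 0 < u) (hx : u⁻¹ ≤ x) :
    (2 * Real.pi * x)⁻¹ ≤ octaveWeight u x := by
  have hx0 : 0 < x := (inv_pos.2 hu).trans_le hx
  have inv_le : (2 * Real.pi * x)⁻¹ ≤ 1 / 2 * x⁻¹ := by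
    rw [mul_inv, mul_inv]
    gcongr ?_ * _
    have := inv_le_one_of_one_le₀ (one_le_two.trans Real.two_le_pi)
    linarith
  refine (le_mul_octaveWeight (D := 1 / 2) hu (by positivity) ?_ ?_).trans_eq (by ring)
  · exact inv_le.trans (by gcongr; exact inv_le_of_inv_le₀ hu hx)
  · rw [abs_of_pos hx0]
    exact (mul_le_mul_of_nonneg_left inv_le hx0.le).trans_eq (by field_simp)

theorem norm_fourier_le_octaveWeight {E : Type*} [NormedAddCommGroup E] [NormedSpace ℂ E]
    {h : ℝ → E} (hh : Integrable h) (hd : Differentiable ℝ h) (hh' : Integrable (deriv h))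
    {u D : ℝ} (hu : 0 < u) (h_le : ∫ t, ‖h t‖ ≤ D * u) (h'_le : ∫ t, ‖deriv h t‖ ≤ D) (ξ : ℝ) :
    ‖𝓕 h ξ‖ ≤ 2 * D * octaveWeight u ξ := by
  have norm_fourier_le (g : ℝ → E) : ‖𝓕 g ξ‖ ≤ ∫ t, ‖g t‖ :=
    VectorFourier.norm_fourierIntegral_le_integral_norm _ volume (innerₗ ℝ) g ξ
  refine le_mul_octaveWeight hu (norm_nonneg _) ((norm_fourier_le h).trans h_le) ?_
  calc |ξ| * ‖𝓕 h ξ‖ ≤ 2 * Real.pi * |ξ| * ‖𝓕 h ξ‖ := by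
        gcongr
        exact le_mul_of_one_le_left (abs_nonneg ξ) (by linarith [Real.pi_gt_three])
    _ = ‖𝓕 (deriv h) ξ‖ := by
        rw [Real.fourier_deriv hh hd hh', norm_smul]
        simp [abs_of_pos Real.pi_pos]
    _ ≤ D := (norm_fourier_le _).trans h'_le

theorem eLpNorm_fourier_le_eLpNorm_octaveWeight {E : Type*} [NormedAddCommGroup E]
    [NormedSpace ℂ E] {h : ℝ → E} (hh : Integrable h) (hd : Differentiable ℝ h)
    (hh' : Integrable (deriv h)) {u D : ℝ} (hu : 0 < u) (h_le : ∫ t, ‖h t‖ ≤ D * u)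
    (h'_le : ∫ t, ‖deriv h t‖ ≤ D) (p : ℝ≥0∞) :
    eLpNorm (𝓕 h) p volume ≤ ENNReal.ofReal (2 * D) * eLpNorm (octaveWeight u) p volume := by
  have hD : 0 ≤ 2 * D :=
    mul_nonneg two_pos.le ((integral_nonneg fun _ => norm_nonneg _).trans h'_le)
  calc eLpNorm (𝓕 h) p volume ≤ eLpNorm ((2 * D) • octaveWeight u) p volume :=
        eLpNorm_mono_real (norm_fourier_le_octaveWeight hh hd hh' hu h_le h'_le)
    _ = _ := by rw [eLpNorm_const_smul, Real.enorm_of_nonneg hD]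

theorem hasCompactSupport_deriv_smoothTransition :
    HasCompactSupport (deriv Real.smoothTransition) := by
  refine HasCompactSupport.intro (isCompact_Icc (a := (0 : ℝ)) (b := 1)) fun x hx => ?_
  rw [mem_Icc, not_and_or, not_le, not_le] at hx
  rcases hx with hx | hx
  · have : Real.smoothTransition =ᶠ[𝓝 x] fun _ => 0 :=
      (eventually_lt_nhds hx).mono fun y hy => Real.smoothTransition.zero_of_nonpos (le_of_lt hy)
    rw [this.deriv_eq, deriv_const]
  · have : Real.smoothTransition =ᶠ[𝓝 x] fun _ => 1 :=
      (eventually_gt_nhds hx).mono fun y hy => Real.smoothTransition.one_of_one_le (le_of_lt hy)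
    rw [this.deriv_eq, deriv_const]

theorem integrable_deriv_smoothTransition : Integrable (deriv Real.smoothTransition) :=
  (Real.smoothTransition.contDiff.continuous_deriv (n := 1) le_rfl).integrable_of_hasCompactSupport
    hasCompactSupport_deriv_smoothTransition

theorem differentiable_smoothTransition : Differentiable ℝ Real.smoothTransition :=
  Real.smoothTransition.contDiff.differentiable (n := 1) one_ne_zero

theorem integral_deriv_smoothTransition : ∫ x, deriv Real.smoothTransition x = 1 := by
  have tendsto_zero : Tendsto Real.smoothTransition atBot (𝓝 0) :=
    tendsto_const_nhds.congr' <| (eventually_le_atBot 0).mono fun x hx =>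
      (Real.smoothTransition.zero_of_nonpos hx).symm
  have tendsto_one : Tendsto Real.smoothTransition atTop (𝓝 1) :=
    tendsto_const_nhds.congr' <| (eventually_ge_atTop 1).mono fun x hx =>
      (Real.smoothTransition.one_of_one_le hx).symm
  simpa using integral_of_hasDerivAt_of_tendsto
    (fun x => (differentiable_smoothTransition x).hasDerivAt) integrable_deriv_smoothTransition
    tendsto_zero tendsto_one

theorem deriv_smoothTransition_comp_affine (a b x : ℝ) :
    deriv (fun s => Real.smoothTransition (a * s + b)) x
      = a * deriv Real.smoothTransition (a * x + b) := by
  have affine : HasDerivAt (fun s => a * s + b) a x := by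
    simpa using ((hasDerivAt_id x).const_mul a).add_const b
  exact ((differentiable_smoothTransition _).hasDerivAt.comp x affine).deriv.trans (mul_comm _ _)

theorem integrable_deriv_smoothTransition_comp_affine {a : ℝ} (ha : a ≠ 0) (b : ℝ) :
    Integrable (deriv fun s => Real.smoothTransition (a * s + b)) := by
  rw [funext (deriv_smoothTransition_comp_affine a b)]
  exact ((integrable_deriv_smoothTransition.comp_add_right b).comp_mul_left' ha).const_mul a

theorem integral_norm_deriv_smoothTransition_comp_affine {a : ℝ} (ha : a ≠ 0) (b : ℝ) :
    ∫ x, ‖deriv (fun s => Real.smoothTransition (a * s + b)) x‖ = 1 := by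
  have deriv_nonneg (x : ℝ) : 0 ≤ deriv Real.smoothTransition x :=
    Real.smoothTransition.monotone.deriv_nonneg
  simp only [deriv_smoothTransition_comp_affine, norm_mul, Real.norm_eq_abs,
    abs_of_nonneg (deriv_nonneg _)]
  rw [integral_const_mul, Measure.integral_comp_mul_left
    (fun x => deriv Real.smoothTransition (x + b)), integral_add_right_eq_self,
    integral_deriv_smoothTransition, smul_eq_mul, mul_one, abs_inv,
    mul_inv_cancel₀ (abs_ne_zero.2 ha)]

theorem tendsto_integral_smoothTransition_smul {E : Type*} [NormedAddCommGroup E]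
    [NormedSpace ℝ E] {m : Measure ℝ} {θ : ℝ → E} (hθ : Integrable θ m) (y : ℝ) :
    Tendsto (fun r : ℝ => ∫ s, Real.smoothTransition (r * (s - y)) • θ s ∂m) atTop
      (𝓝 (∫ s in Ioi y, θ s ∂m)) := by
  rw [← integral_indicator measurableSet_Ioi]
  refine tendsto_integral_filter_of_dominated_convergence (fun s => ‖θ s‖)
    (Eventually.of_forall fun r => ?_) (Eventually.of_forall fun r => ae_of_all _ fun s => ?_)
    hθ.norm (ae_of_all _ fun s => ?_)
  · exact (Real.smoothTransition.continuous.comp (by fun_prop)).aestronglyMeasurable.smul hθ.1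
  · rw [norm_smul, Real.norm_of_nonneg (Real.smoothTransition.nonneg _)]
    exact mul_le_of_le_one_left (norm_nonneg _) (Real.smoothTransition.le_one _)
  · refine tendsto_const_nhds.congr' ?_
    rcases le_or_gt s y with hs | hs
    · filter_upwards [eventually_ge_atTop 0] with r hr
      rw [indicator_of_notMem (notMem_Ioi.2 hs), Real.smoothTransition.zero_of_nonpos
        (mul_nonpos_of_nonneg_of_nonpos hr (sub_nonpos.2 hs)), zero_smul]
    · filter_upwards [eventually_ge_atTop (s - y)⁻¹] with r hr
      rw [indicator_of_mem (mem_Ioi.2 hs), Real.smoothTransition.one_of_one_le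
        ((inv_le_iff_one_le_mul₀ (sub_pos.2 hs)).1 hr), one_smul]

theorem integral_norm_deriv_mul_le {𝔸 : Type*} [NormedCommRing 𝔸] [NormedAlgebra ℝ 𝔸]
    {f g : ℝ → 𝔸} (hf : Differentiable ℝ f) (hg : Differentiable ℝ g)
    (hf' : Integrable (deriv f)) (hg' : Integrable (deriv g))
    (f_le : ∀ x, ‖f x‖ ≤ 1) (g_le : ∀ x, ‖g x‖ ≤ 1) :
    ∫ x, ‖deriv (fun y => f y * g y) x‖ ≤ (∫ x, ‖deriv f x‖) + ∫ x, ‖deriv g x‖ := by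
  rw [← integral_add hf'.norm hg'.norm]
  refine integral_mono_of_nonneg (ae_of_all _ fun x => norm_nonneg _) (hf'.norm.add hg'.norm)
    (ae_of_all _ fun x => ?_)
  beta_reduce
  rw [deriv_fun_mul (hf x) (hg x)]
  refine (norm_add_le _ _).trans (add_le_add ?_ ?_)
  · exact (norm_mul_le _ _).trans (mul_le_of_le_one_right (norm_nonneg _) (g_le x))
  · exact (norm_mul_le _ _).trans (mul_le_of_le_one_left (norm_nonneg _) (f_le x))

/-- A smooth cut-off which on the octave `(u, 2u)` approximates the indicator of `(y, ∞)` as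
`r → ∞`, and which vanishes beyond `3u`. -/
noncomputable def octaveCutoff (u y r s : ℝ) : ℝ :=
  Real.smoothTransition (r * (s - y)) * Real.smoothTransition (3 - s / u)

section OctaveCutoff

variable {u y r : ℝ}

theorem norm_octaveCutoff_le_one (u y r s : ℝ) : ‖octaveCutoff u y r s‖ ≤ 1 := by
  rw [octaveCutoff, norm_mul, Real.norm_of_nonneg (Real.smoothTransition.nonneg _),
    Real.norm_of_nonneg (Real.smoothTransition.nonneg _)]
  exact mul_le_one₀ (Real.smoothTransition.le_one _) (Real.smoothTransition.nonneg _)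
    (Real.smoothTransition.le_one _)

theorem contDiff_octaveCutoff (u y r : ℝ) {n : ℕ∞} : ContDiff ℝ n (octaveCutoff u y r) :=
  (Real.smoothTransition.contDiff.comp (by fun_prop)).mul
    (Real.smoothTransition.contDiff.comp (by fun_prop))

theorem octaveCutoff_eq_zero_of_notMem_Icc (hu : 0 < u) (hy : u ≤ y) (hr : 0 ≤ r) {s : ℝ}
    (hs : s ∉ Icc u (3 * u)) : octaveCutoff u y r s = 0 := by
  rw [mem_Icc, not_and_or, not_le, not_le] at hs
  rcases hs with hs | hs
  · rw [octaveCutoff, Real.smoothTransition.zero_of_nonpos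
      (mul_nonpos_of_nonneg_of_nonpos hr (by linarith)), zero_mul]
  · rw [octaveCutoff, Real.smoothTransition.zero_of_nonpos (x := 3 - s / u)
      (sub_nonpos.2 ((le_div_iff₀ hu).2 hs.le)), mul_zero]

theorem octaveCutoff_eq_smoothTransition (hu : 0 < u) {s : ℝ} (hs : s ≤ 2 * u) :
    octaveCutoff u y r s = Real.smoothTransition (r * (s - y)) := by
  have : s / u ≤ 2 := (div_le_iff₀ hu).2 hs
  rw [octaveCutoff, Real.smoothTransition.one_of_one_le (x := 3 - s / u) (by linarith), mul_one]

theorem hasCompactSupport_octaveCutoff (hu : 0 < u) (hy : u ≤ y) (hr : 0 ≤ r) :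
    HasCompactSupport (octaveCutoff u y r) :=
  HasCompactSupport.intro isCompact_Icc fun _ => octaveCutoff_eq_zero_of_notMem_Icc hu hy hr

theorem integral_norm_octaveCutoff_le (hu : 0 < u) (hy : u ≤ y) (hr : 0 ≤ r) :
    ∫ s, ‖octaveCutoff u y r s‖ ≤ 2 * u := by
  have eq_zero (s : ℝ) (hs : s ∉ Icc u (3 * u)) : ‖octaveCutoff u y r s‖ = 0 := by
    rw [octaveCutoff_eq_zero_of_notMem_Icc hu hy hr hs, norm_zero]
  rw [← setIntegral_eq_integral_of_forall_compl_eq_zero eq_zero]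
  calc ∫ s in Icc u (3 * u), ‖octaveCutoff u y r s‖ ≤ ∫ _ in Icc u (3 * u), (1 : ℝ) :=
        integral_mono_of_nonneg (ae_of_all _ fun _ => norm_nonneg _) (integrable_const _)
          (ae_of_all _ (norm_octaveCutoff_le_one u y r))
    _ = 2 * u := by
        rw [setIntegral_one_eq_measureReal, Real.volume_real_Icc_of_le (by linarith)]
        ring

theorem integral_norm_deriv_octaveCutoff_le (hu : 0 < u) (hr : 0 < r) (y : ℝ) :
    ∫ s, ‖deriv (octaveCutoff u y r) s‖ ≤ 2 := by
  have eq_affine : octaveCutoff u y r = fun s => Real.smoothTransition (r * s + -(r * y)) *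
      Real.smoothTransition (-u⁻¹ * s + 3) := by
    ext s; rw [octaveCutoff]; ring_nf
  have differentiable_factor (a b : ℝ) :
      Differentiable ℝ fun s => Real.smoothTransition (a * s + b) :=
    differentiable_smoothTransition.fun_comp (by fun_prop)
  have norm_factor_le (a b s : ℝ) : ‖Real.smoothTransition (a * s + b)‖ ≤ 1 :=
    (Real.norm_of_nonneg (Real.smoothTransition.nonneg _)).trans_le
      (Real.smoothTransition.le_one _)
  have hu' : -u⁻¹ ≠ 0 := neg_ne_zero.2 (inv_ne_zero hu.ne')
  rw [eq_affine]
  refine (integral_norm_deriv_mul_le (differentiable_factor _ _) (differentiable_factor _ _)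
    (integrable_deriv_smoothTransition_comp_affine hr.ne' _)
    (integrable_deriv_smoothTransition_comp_affine hu' _) (norm_factor_le _ _)
    (norm_factor_le _ _)).trans_eq ?_
  rw [integral_norm_deriv_smoothTransition_comp_affine hr.ne',
    integral_norm_deriv_smoothTransition_comp_affine hu', one_add_one_eq_two]

theorem exists_schwartzMap_eq_octaveCutoff (hu : 0 < u) (hy : u ≤ y) (hr : 0 < r) (p : ℝ≥0∞) :
    ∃ h : 𝓢(ℝ, ℂ), (∀ s, h s = octaveCutoff u y r s) ∧
      eLpNorm (𝓕 (h : ℝ → ℂ)) p volume ≤ 4 * eLpNorm (octaveWeight u) p volume := by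
  set h : 𝓢(ℝ, ℂ) :=
    ((hasCompactSupport_octaveCutoff hu hy hr.le).comp_left Complex.ofReal_zero).toSchwartzMap
      (Complex.ofRealCLM.contDiff.comp (contDiff_octaveCutoff u y r))
  refine ⟨h, fun s => rfl, ?_⟩
  have deriv_h (s : ℝ) : deriv h s = ((deriv (octaveCutoff u y r) s : ℝ) : ℂ) :=
    ((contDiff_octaveCutoff u y r (n := 1)).differentiable (by norm_num)
      s).hasDerivAt.ofReal_comp.deriv
  have h_le : ∫ s, ‖h s‖ ≤ 2 * u := by
    refine le_trans (le_of_eq ?_) (integral_norm_octaveCutoff_le hu hy hr.le)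
    exact integral_congr_ae (ae_of_all _ fun s => Complex.norm_real _)
  have h'_le : ∫ s, ‖deriv h s‖ ≤ 2 := by
    simpa only [deriv_h, Complex.norm_real] using integral_norm_deriv_octaveCutoff_le hu hr y
  refine (eLpNorm_fourier_le_eLpNorm_octaveWeight h.integrable h.differentiable
    (SchwartzMap.derivCLM ℝ ℂ h).integrable hu h_le h'_le p).trans_eq ?_
  norm_num

end OctaveCutoff

section Tail

variable {p : ℝ≥0∞} {m : Measure ℝ} {θ : ℝ → ℂ} {u : ℝ}

theorem enorm_setIntegral_Ioi_le_of_le (hp : p ≠ 0) (hu : 0 < u)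
    (hm : ∀ᵐ s ∂m, s ∈ Ioo u (2 * u)) (hθ : Integrable θ m) {y : ℝ} (hy : u ≤ y) :
    ‖∫ s in Ioi y, θ s ∂m‖ₑ
      ≤ 4 * (eLpNorm (octaveWeight u) p volume * starNorm p (m.withDensityᵥ θ)) := by
  refine le_of_tendsto (tendsto_integral_smoothTransition_smul hθ y).enorm ?_
  filter_upwards [eventually_gt_atTop 0] with r hr
  obtain ⟨h, h_eq, h_le⟩ := exists_schwartzMap_eq_octaveCutoff hu hy hr p
  have integral_eq : ∫ s, Real.smoothTransition (r * (s - y)) • θ s ∂m = ∫ s, h s * θ s ∂m := by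
    refine integral_congr_ae ?_
    filter_upwards [hm] with s hs
    rw [← octaveCutoff_eq_smoothTransition hu hs.2.le, Complex.real_smul,
      h_eq]
  rw [integral_eq, ← mul_assoc]
  refine (enorm_integral_mul_le_eLpNorm_fourier_mul_starNorm hp hθ h).trans ?_
  gcongr

theorem enorm_setIntegral_Ioi_le (hp : p ≠ 0) (hu : 0 < u)
    (hm : ∀ᵐ s ∂m, s ∈ Ioo u (2 * u)) (hθ : Integrable θ m) (y : ℝ) :
    ‖∫ s in Ioi y, θ s ∂m‖ₑ
      ≤ 4 * (eLpNorm (octaveWeight u) p volume * starNorm p (m.withDensityᵥ θ)) := by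
  have Ioi_ae_eq : (Ioi y : Set ℝ) =ᵐ[m] Ioi (max u y) := by
    filter_upwards [hm] with s hs
    exact propext (max_lt_iff.trans (and_iff_right hs.1)).symm
  rw [setIntegral_congr_set Ioi_ae_eq]
  exact enorm_setIntegral_Ioi_le_of_le hp hu hm hθ (le_max_left u y)

end Tail

section Fubini

variable {E : Type*} [NormedAddCommGroup E] [NormedSpace ℝ E] {μ m : Measure ℝ}
  {g : ℝ → ℝ} {θ : ℝ → E}

theorem integrable_indicator_lt_smul (hg : Integrable g μ) (hθ : Integrable θ m) :
    Integrable (fun z : ℝ × ℝ => (Ioi z.1).indicator (fun s => g z.1 • θ s) z.2) (μ.prod m) :=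
  (hg.smul_prod hθ).indicator (measurableSet_lt measurable_fst measurable_snd)

theorem integrable_smul_setIntegral_Ioi [SFinite μ] [SFinite m] (hg : Integrable g μ)
    (hθ : Integrable θ m) :
    Integrable (fun t => g t • ∫ s in Ioi t, θ s ∂m) μ := by
  simpa only [integral_indicator measurableSet_Ioi, integral_smul] using
    (integrable_indicator_lt_smul hg hθ).integral_prod_left

theorem integral_smul_setIntegral_Ioi [CompleteSpace E] [SFinite μ] [SFinite m]
    (hg : Integrable g μ) (hθ : Integrable θ m) :
    ∫ t, g t • ∫ s in Ioi t, θ s ∂m ∂μ = ∫ s, (∫ t in Iio s, g t ∂μ) • θ s ∂m := by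
  have swap := integral_integral_swap
    (f := fun t s => (Ioi t).indicator (fun s => g t • θ s) s) (integrable_indicator_lt_smul hg hθ)
  have inner_eq (s : ℝ) : ∫ t, (Ioi t).indicator (fun s => g t • θ s) s ∂μ
      = (∫ t in Iio s, g t ∂μ) • θ s := by
    rw [← integral_smul_const, ← integral_indicator measurableSet_Iio]
    exact integral_congr_ae (ae_of_all _ fun t => by simp [indicator])
  simpa only [integral_indicator measurableSet_Ioi, integral_smul, inner_eq] using swap

end Fubini

/-- The primitive `2πx ∫₀ˢ cos 2π(xt - γ) dt` of the transform kernel, as a function of `xs`. -/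
noncomputable def trigKernel (γ t : ℝ) : ℝ :=
  Real.sin (2 * Real.pi * (t - γ)) + Real.sin (2 * Real.pi * γ)

@[fun_prop]
theorem continuous_trigKernel (γ : ℝ) : Continuous (trigKernel γ) := by
  unfold trigKernel; fun_prop

theorem norm_trigKernel_le_two (γ t : ℝ) : ‖trigKernel γ t‖ ≤ 2 :=
  (norm_add_le _ _).trans
    ((add_le_add (Real.abs_sin_le_one _) (Real.abs_sin_le_one _)).trans_eq one_add_one_eq_two)

theorem integral_cos_eq_trigKernel {x : ℝ} (hx : x ≠ 0) (γ s : ℝ) :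
    ∫ t in 0..s, Real.cos (2 * Real.pi * (x * t - γ))
      = (2 * Real.pi * x)⁻¹ * trigKernel γ (x * s) := by
  have hpi : 2 * Real.pi * x ≠ 0 := mul_ne_zero Real.two_pi_pos.ne' hx
  have affine (t : ℝ) :
      2 * Real.pi * (x * t - γ) = 2 * Real.pi * x * t - 2 * Real.pi * γ := by ring
  simp only [affine, intervalIntegral.integral_comp_mul_sub _ hpi, integral_cos]
  rw [trigKernel, affine, smul_eq_mul, mul_zero, zero_sub, Real.sin_neg, sub_neg_eq_add]

section TrigTransform

variable {E : Type*} [NormedAddCommGroup E] [NormedSpace ℝ E]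

/-- The transform `∫₀^∞ F(t) cos 2π(xt - γ) dt` of the tail `F(t) = ∫_{(t, ∞)} θ dm` of a measure
`θ dm` on `(0, ∞)`, integrated by parts. -/
noncomputable def tailTransform (γ : ℝ) (m : Measure ℝ) (θ : ℝ → E) (x : ℝ) : E :=
  (2 * Real.pi * x)⁻¹ • ∫ s, trigKernel γ (x * s) • θ s ∂m

variable {m : Measure ℝ} {θ : ℝ → E} {x : ℝ}

theorem integrable_trigKernel_smul (hθ : Integrable θ m) (γ x : ℝ) :
    Integrable (fun s => trigKernel γ (x * s) • θ s) m :=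
  hθ.bdd_smul 2 (Continuous.aestronglyMeasurable (by fun_prop) :
    AEStronglyMeasurable (fun s => trigKernel γ (x * s)) m)
    (ae_of_all _ fun _ => norm_trigKernel_le_two γ _)

theorem integrableOn_cos_smul_setIntegral_Ioi [SFinite m] (hθ : Integrable θ m) (x γ R : ℝ) :
    IntegrableOn (fun t => Real.cos (2 * Real.pi * (x * t - γ)) • ∫ s in Ioi t, θ s ∂m)
      (Ioc 0 R) volume :=
  integrable_smul_setIntegral_Ioi (Continuous.integrableOn_Ioc (by fun_prop)) hθ

theorem setIntegral_cos_smul_setIntegral_Ioi [CompleteSpace E] [SFinite m]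
    (hm : ∀ᵐ s ∂m, 0 < s) (hθ : Integrable θ m) (hx : x ≠ 0) (γ : ℝ) {R : ℝ} (hR : 0 ≤ R) :
    ∫ t in Ioc 0 R, Real.cos (2 * Real.pi * (x * t - γ)) • ∫ s in Ioi t, θ s ∂m
      = (2 * Real.pi * x)⁻¹ • ∫ s, trigKernel γ (x * min s R) • θ s ∂m := by
  rw [integral_smul_setIntegral_Ioi (Continuous.integrableOn_Ioc (by fun_prop)) hθ,
    ← integral_smul]
  refine integral_congr_ae ?_
  filter_upwards [hm] with s hs
  rw [smul_smul, ← integral_cos_eq_trigKernel hx, intervalIntegral.integral_of_le (le_min hs.le hR),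
    Measure.restrict_restrict measurableSet_Iio, inter_comm]
  have Ioc_ae_eq : (Ioc 0 R ∩ Iio s : Set ℝ) =ᵐ[volume] (Ioc 0 R ∩ Iic s : Set ℝ) :=
    (ae_eq_refl _).inter Iio_ae_eq_Iic
  rw [setIntegral_congr_set Ioc_ae_eq, Ioc_inter_Iic, min_comm]

theorem tendsto_setIntegral_cos_smul_setIntegral_Ioi [CompleteSpace E] [SFinite m]
    (hm : ∀ᵐ s ∂m, 0 < s) (hθ : Integrable θ m) (hx : x ≠ 0) (γ : ℝ) :
    Tendsto (fun R : ℝ => ∫ t in Ioc 0 R,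
      Real.cos (2 * Real.pi * (x * t - γ)) • ∫ s in Ioi t, θ s ∂m) atTop
      (𝓝 (tailTransform γ m θ x)) := by
  have tendsto_integral : Tendsto (fun R : ℝ => ∫ s, trigKernel γ (x * min s R) • θ s ∂m) atTop
      (𝓝 (∫ s, trigKernel γ (x * s) • θ s ∂m)) := by
    refine tendsto_integral_filter_of_dominated_convergence (fun s => 2 * ‖θ s‖)
      (Eventually.of_forall fun R =>
        (Continuous.aestronglyMeasurable (by fun_prop)).smul hθ.aestronglyMeasurable)
      (Eventually.of_forall fun R => ae_of_all _ fun s => ?_) (hθ.norm.const_mul 2)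
      (ae_of_all _ fun s => tendsto_const_nhds.congr' ?_)
    · rw [norm_smul]
      gcongr
      exact norm_trigKernel_le_two _ _
    · filter_upwards [eventually_ge_atTop s] with R hR
      rw [min_eq_left hR]
  refine (tendsto_integral.const_smul (2 * Real.pi * x)⁻¹).congr' ?_
  filter_upwards [eventually_ge_atTop 0] with R hR
  exact (setIntegral_cos_smul_setIntegral_Ioi hm hθ hx γ hR).symm

theorem enorm_tailTransform_le [CompleteSpace E] [SFinite m] {R : ℝ}
    (hm : ∀ᵐ s ∂m, s ∈ Ioc 0 R) (hθ : Integrable θ m) (hx : x ≠ 0) (γ : ℝ) (hR : 0 ≤ R) {B : ℝ≥0∞}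
    (tail_le : ∀ y, ‖∫ s in Ioi y, θ s ∂m‖ₑ ≤ B) :
    ‖tailTransform γ m θ x‖ₑ ≤ ENNReal.ofReal R * B := by
  have tailTransform_eq : tailTransform γ m θ x = ∫ t in Ioc 0 R,
      Real.cos (2 * Real.pi * (x * t - γ)) • ∫ s in Ioi t, θ s ∂m := by
    rw [setIntegral_cos_smul_setIntegral_Ioi (hm.mono fun s hs => hs.1) hθ hx γ hR, tailTransform]
    congr 1
    refine integral_congr_ae ?_
    filter_upwards [hm] with s hs
    rw [min_eq_left hs.2]
  calc ‖tailTransform γ m θ x‖ₑ ≤ ∫⁻ t in Ioc 0 R,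
        ‖Real.cos (2 * Real.pi * (x * t - γ)) • ∫ s in Ioi t, θ s ∂m‖ₑ := by
        rw [tailTransform_eq]
        exact enorm_integral_le_lintegral_enorm _
    _ ≤ ∫⁻ _ in Ioc 0 R, B := by
        refine lintegral_mono fun t => ?_
        rw [enorm_smul, ← one_mul B]
        gcongr
        · rw [← ofReal_norm]
          exact ENNReal.ofReal_le_one.2 (Real.abs_cos_le_one _)
        · exact tail_le t
    _ = ENNReal.ofReal R * B := by
        rw [setLIntegral_const, Real.volume_Ioc, sub_zero, mul_comm]

end TrigTransform

section Duality

/-- The phase `conj z / |z|`, regularized by `ε > 0` so as to be smooth at `z = 0`. -/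
noncomputable def regularizedPhase (ε : ℝ) (z : ℂ) : ℂ :=
  ((√(‖z‖ ^ 2 + ε))⁻¹ : ℝ) • (starRingEnd ℂ) z

theorem norm_regularizedPhase_le_one {ε : ℝ} (hε : 0 ≤ ε) (z : ℂ) :
    ‖regularizedPhase ε z‖ ≤ 1 := by
  rw [regularizedPhase, norm_smul, RCLike.norm_conj, Real.norm_of_nonneg (by positivity)]
  exact inv_mul_le_one_of_le₀ (Real.le_sqrt_of_sq_le (le_add_of_nonneg_right hε)) (by positivity)

theorem regularizedPhase_mul_self (ε : ℝ) (z : ℂ) :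
    regularizedPhase ε z * z = ((‖z‖ ^ 2 / √(‖z‖ ^ 2 + ε) : ℝ) : ℂ) := by
  rw [regularizedPhase, smul_mul_assoc, Complex.conj_mul', Complex.real_smul]
  push_cast
  exact inv_mul_eq_div _ _

theorem contDiff_regularizedPhase {ε : ℝ} (hε : 0 < ε) {n : ℕ∞} :
    ContDiff ℝ n (regularizedPhase ε) := by
  have (z : ℂ) : 0 < ‖z‖ ^ 2 + ε := by positivity
  exact ((((contDiff_norm_sq ℝ).add contDiff_const).sqrt fun z => (this z).ne').inv
    fun z => (Real.sqrt_pos.2 (this z)).ne').smul Complex.conjCLE.contDiff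

theorem tendsto_sq_div_sqrt_sq_add {a : ℝ} (ha : 0 ≤ a) :
    Tendsto (fun ε : ℝ => a ^ 2 / √(a ^ 2 + ε)) (𝓝 0) (𝓝 a) := by
  rcases ha.eq_or_lt with rfl | ha
  · simp
  · have : Tendsto (fun ε : ℝ => a ^ 2 / √(a ^ 2 + ε)) (𝓝 0) (𝓝 (a ^ 2 / √(a ^ 2 + 0))) :=
      ContinuousAt.tendsto (by fun_prop (disch := positivity))
    rwa [add_zero, Real.sqrt_sq ha.le, pow_two a, mul_self_div_self, ← pow_two] at this

variable {V : Type*} [NormedAddCommGroup V] [NormedSpace ℝ V] [FiniteDimensional ℝ V]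
  [MeasurableSpace V] [BorelSpace V] {μ : Measure V} [IsFiniteMeasureOnCompacts μ]
  {w : V → ℝ} {φ : V → ℂ} {B : ℝ≥0∞}

theorem lintegral_bump_mul_regularizedPhase_le (hw : ContDiff ℝ (⊤ : ℕ∞) w)
    (w_nonneg : ∀ x, 0 ≤ w x) (hφ : ContDiff ℝ (⊤ : ℕ∞) φ)
    (duality : ∀ g : V → ℂ, HasCompactSupport g → ContDiff ℝ (⊤ : ℕ∞) g → (∀ x, ‖g x‖ ≤ w x) →
      ‖∫ x, g x * φ x ∂μ‖ₑ ≤ B)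
    (χ : ContDiffBump (0 : V)) {ε : ℝ} (hε : 0 < ε) :
    ∫⁻ x, ENNReal.ofReal (χ x * w x * (‖φ x‖ ^ 2 / √(‖φ x‖ ^ 2 + ε))) ∂μ ≤ B := by
  set g : V → ℂ := fun x => (χ x * w x) • regularizedPhase ε (φ x)
  have hg : ContDiff ℝ (⊤ : ℕ∞) g :=
    (χ.contDiff.mul hw).smul ((contDiff_regularizedPhase hε).comp hφ)
  have hg_supp : HasCompactSupport g := χ.hasCompactSupport.mul_right.smul_right
  have g_le (x : V) : ‖g x‖ ≤ w x := by
    calc ‖g x‖ = χ x * w x * ‖regularizedPhase ε (φ x)‖ := by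
          rw [norm_smul, Real.norm_of_nonneg (mul_nonneg χ.nonneg (w_nonneg x))]
      _ ≤ 1 * w x * 1 := by
          have := w_nonneg x
          gcongr
          exacts [χ.le_one, norm_regularizedPhase_le_one hε.le _]
      _ = w x := by ring
  have g_mul (x : V) :
      g x * φ x = ((χ x * w x * (‖φ x‖ ^ 2 / √(‖φ x‖ ^ 2 + ε)) : ℝ) : ℂ) := by
    rw [smul_mul_assoc, regularizedPhase_mul_self, Complex.real_smul, ← Complex.ofReal_mul]
  have nonneg (x : V) : 0 ≤ χ x * w x * (‖φ x‖ ^ 2 / √(‖φ x‖ ^ 2 + ε)) :=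
    mul_nonneg (mul_nonneg χ.nonneg (w_nonneg x)) (by positivity)
  have integrable_g_mul : Integrable (fun x => g x * φ x) μ :=
    (hg.continuous.mul hφ.continuous).integrable_of_hasCompactSupport hg_supp.mul_right
  have integrable : Integrable (fun x => χ x * w x * (‖φ x‖ ^ 2 / √(‖φ x‖ ^ 2 + ε))) μ := by
    simp only [g_mul] at integrable_g_mul
    exact integrable_g_mul.re
  refine le_of_eq_of_le ?_ (duality g hg_supp hg g_le)
  simp only [g_mul]
  rw [← ofReal_integral_eq_lintegral_ofReal integrable (ae_of_all _ nonneg),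
    integral_complex_ofReal, ← ofReal_norm, Complex.norm_real,
    Real.norm_of_nonneg (integral_nonneg nonneg)]

theorem lintegral_mul_enorm_le_of_forall_enorm_integral_le (hw : ContDiff ℝ (⊤ : ℕ∞) w)
    (w_nonneg : ∀ x, 0 ≤ w x) (hφ : ContDiff ℝ (⊤ : ℕ∞) φ)
    (duality : ∀ g : V → ℂ, HasCompactSupport g → ContDiff ℝ (⊤ : ℕ∞) g → (∀ x, ‖g x‖ ≤ w x) →
      ‖∫ x, g x * φ x ∂μ‖ₑ ≤ B) :
    ∫⁻ x, ENNReal.ofReal (w x) * ‖φ x‖ₑ ∂μ ≤ B := by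
  let χ (n : ℕ) : ContDiffBump (0 : V) := ⟨n + 1, n + 2, by positivity, by linarith⟩
  let ψ (n : ℕ) (x : V) : ℝ≥0∞ :=
    ENNReal.ofReal (χ n x * w x * (‖φ x‖ ^ 2 / √(‖φ x‖ ^ 2 + 1 / (n + 1))))
  have tendsto_ψ (x : V) :
      Tendsto (fun n => ψ n x) atTop (𝓝 (ENNReal.ofReal (w x) * ‖φ x‖ₑ)) := by
    rw [← ofReal_norm, ← ENNReal.ofReal_mul (w_nonneg x)]
    refine (ENNReal.continuous_ofReal.tendsto _).comp ?_
    refine (((tendsto_sq_div_sqrt_sq_add (norm_nonneg (φ x))).comp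
      tendsto_one_div_add_atTop_nhds_zero_nat).const_mul (w x)).congr' ?_
    filter_upwards [eventually_ge_atTop ⌈‖x‖⌉₊] with n hn
    have χ_eq_one : χ n x = 1 := (χ n).one_of_mem_closedBall <| mem_closedBall_zero_iff.2 <|
      (Nat.ceil_le.1 hn).trans (le_add_of_nonneg_right zero_le_one)
    rw [χ_eq_one, one_mul]
    rfl
  have measurable_ψ (n : ℕ) : Measurable (ψ n) := by
    have := hφ.continuous.measurable
    have := hw.continuous.measurable
    have := (χ n).continuous.measurable
    fun_prop
  calc ∫⁻ x, ENNReal.ofReal (w x) * ‖φ x‖ₑ ∂μ = ∫⁻ x, liminf (fun n => ψ n x) atTop ∂μ :=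
        lintegral_congr fun x => (tendsto_ψ x).liminf_eq.symm
    _ ≤ liminf (fun n => ∫⁻ x, ψ n x ∂μ) atTop := lintegral_liminf_le measurable_ψ
    _ ≤ liminf (fun _ : ℕ => B) atTop :=
        liminf_le_liminf <| Eventually.of_forall fun n =>
          lintegral_bump_mul_regularizedPhase_le hw w_nonneg hφ duality (χ n) (by positivity)
    _ = B := liminf_const B

end Duality

section ConjugateFourier

/-- The conjugate Fourier transform `∫ e^{2πitξ} θ(t) dm(t)` of the vector measure `θ dm`. -/
noncomputable def densityFourierInv {E : Type*} [NormedAddCommGroup E] [NormedSpace ℂ E]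
    (m : Measure ℝ) (θ : ℝ → E) (ξ : ℝ) : E :=
  ∫ t, Real.fourierChar (t * ξ) • θ t ∂m

variable {E : Type*} [NormedAddCommGroup E] [NormedSpace ℂ E] {m : Measure ℝ}

theorem densityFourierInv_eq_fourierIntegral (m : Measure ℝ) (θ : ℝ → E) :
    densityFourierInv m θ = VectorFourier.fourierIntegral Real.fourierChar m
      (-(ContinuousLinearMap.mul ℝ ℝ)).toLinearMap₁₂ θ := by
  ext ξ; simp [densityFourierInv, VectorFourier.fourierIntegral]

theorem fourierInv_eq_densityFourierInv (g : ℝ → E) :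
    𝓕⁻ g = densityFourierInv volume g := by
  ext ξ; simp [densityFourierInv, Real.fourierInv_eq, mul_comm]

theorem contDiff_densityFourierInv {θ : ℝ → E} (hθ : Integrable θ m) {R : ℝ}
    (hm : ∀ᵐ s ∂m, ‖s‖ ≤ R) : ContDiff ℝ (⊤ : ℕ∞) (densityFourierInv m θ) := by
  rw [densityFourierInv_eq_fourierIntegral]
  refine VectorFourier.contDiff_fourierIntegral _ fun n _ => ?_
  refine Integrable.bdd_mul (c := R ^ n) hθ.norm (by fun_prop) ?_
  filter_upwards [hm] with s hs
  rw [norm_pow, norm_norm]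
  gcongr

theorem integral_fourierInv_smul_eq [CompleteSpace E] [SigmaFinite m] {g : ℝ → ℂ}
    (hg : Integrable g) {θ : ℝ → E} (hθ : Integrable θ m) :
    ∫ t, 𝓕⁻ g t • θ t ∂m = ∫ ξ, g ξ • densityFourierInv m θ ξ := by
  simp only [fourierInv_eq_densityFourierInv, densityFourierInv_eq_fourierIntegral]
  refine (VectorFourier.integral_fourierIntegral_smul_eq_flip Real.continuous_fourierChar
    (by fun_prop) hg hθ).trans ?_
  congr! 4
  ext; simp

theorem lintegral_octaveWeight_mul_densityFourierInv_le [SigmaFinite m] {p : ℝ≥0∞}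
    (hp : p ≠ 0) {θ : ℝ → ℂ} (hθ : Integrable θ m) {R : ℝ} (hm : ∀ᵐ s ∂m, ‖s‖ ≤ R)
    {u : ℝ} (hu : 0 < u) :
    ∫⁻ x, ENNReal.ofReal (octaveWeight u x) * ‖densityFourierInv m θ x‖ₑ
      ≤ eLpNorm (octaveWeight u) p volume * starNorm p (m.withDensityᵥ θ) := by
  refine lintegral_mul_enorm_le_of_forall_enorm_integral_le (contDiff_octaveWeight u)
    (fun x => (octaveWeight_pos hu x).le) (contDiff_densityFourierInv hθ hm)
    fun g g_supp hg g_le => ?_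
  set G : 𝓢(ℝ, ℂ) := g_supp.toSchwartzMap hg
  have fourier_eq : 𝓕 ((𝓕⁻ G : 𝓢(ℝ, ℂ)) : ℝ → ℂ) = g := by
    rw [← SchwartzMap.fourier_coe, FourierTransform.fourier_fourierInv_eq G]; rfl
  calc ‖∫ x, g x * densityFourierInv m θ x‖ₑ = ‖∫ t, (𝓕⁻ G : 𝓢(ℝ, ℂ)) t * θ t ∂m‖ₑ := by
        rw [SchwartzMap.fourierInv_coe]
        exact congrArg _ (integral_fourierInv_smul_eq G.integrable hθ).symm
    _ ≤ eLpNorm g p volume * starNorm p (m.withDensityᵥ θ) := by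
        rw [← fourier_eq]
        exact enorm_integral_mul_le_eLpNorm_fourier_mul_starNorm hp hθ _
    _ ≤ _ := by
        gcongr
        exact eLpNorm_mono_real g_le

end ConjugateFourier

/-- The kernel `2πx ∫₀ˢ cos 2π(xt - γ) dt` with its average `sin 2πγ` removed beyond `s = 1/x`. -/
noncomputable def remainderKernel (γ x s : ℝ) : ℝ :=
  trigKernel γ (x * s) - (Ioi (1 / x)).indicator (fun _ => Real.sin (2 * Real.pi * γ)) s

/-- The transform of the tail `F(t) = ∫_{(t, ∞)} θ dm` minus its main term
`(2πx)⁻¹ F(1/x) sin 2πγ`; see `remainder_eq`. -/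
noncomputable def remainder {E : Type*} [NormedAddCommGroup E] [NormedSpace ℝ E] (γ : ℝ)
    (m : Measure ℝ) (θ : ℝ → E) (x : ℝ) : E :=
  (2 * Real.pi * x)⁻¹ • ∫ s, remainderKernel γ x s • θ s ∂m

section Remainder

variable {E : Type*} [NormedAddCommGroup E] [NormedSpace ℝ E] {m : Measure ℝ} {θ : ℝ → E}
  {u x : ℝ}

theorem remainder_eq (hθ : Integrable θ m) (γ x : ℝ) :
    remainder γ m θ x = tailTransform γ m θ x
      - (2 * Real.pi * x)⁻¹ • Real.sin (2 * Real.pi * γ) • ∫ s in Ioi (1 / x), θ s ∂m := by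
  have integrable_jump :
      Integrable ((Ioi (1 / x)).indicator fun s => Real.sin (2 * Real.pi * γ) • θ s) m :=
    (hθ.smul (Real.sin (2 * Real.pi * γ))).indicator measurableSet_Ioi
  have integral_jump : Real.sin (2 * Real.pi * γ) • ∫ s in Ioi (1 / x), θ s ∂m
      = ∫ s, (Ioi (1 / x)).indicator (fun s => Real.sin (2 * Real.pi * γ) • θ s) s ∂m := by
    rw [integral_indicator measurableSet_Ioi, integral_smul]
  rw [remainder, tailTransform, integral_jump, ← smul_sub,
    ← integral_sub (integrable_trigKernel_smul hθ γ x) integrable_jump]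
  simp only [remainderKernel, sub_smul, indicator_smul_left]

theorem enorm_remainder_le [CompleteSpace E] [SFinite m] (hu : 0 < u)
    (hm : ∀ᵐ s ∂m, s ∈ Ioo u (2 * u)) (hθ : Integrable θ m) {B : ℝ≥0∞}
    (tail_le : ∀ y, ‖∫ s in Ioi y, θ s ∂m‖ₑ ≤ B) (hx : 0 < x) (γ : ℝ) :
    ‖remainder γ m θ x‖ₑ ≤ ENNReal.ofReal (3 * u) * B := by
  have transform_le : ‖tailTransform γ m θ x‖ₑ ≤ ENNReal.ofReal (2 * u) * B :=
    enorm_tailTransform_le (hm.mono fun s hs => ⟨hu.trans hs.1, hs.2.le⟩) hθ hx.ne' γ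
      (by positivity) tail_le
  have jump_le : ‖(2 * Real.pi * x)⁻¹ • Real.sin (2 * Real.pi * γ) •
      ∫ s in Ioi (1 / x), θ s ∂m‖ₑ ≤ ENNReal.ofReal u * B := by
    rcases le_or_gt (2 * u) (1 / x) with h | h
    · have Ioi_ae_eq : (Ioi (1 / x) : Set ℝ) =ᵐ[m] (∅ : Set ℝ) := by
        filter_upwards [hm] with s hs
        exact propext (iff_of_false (hs.2.le.trans h).not_gt (notMem_empty s))
      rw [setIntegral_congr_set Ioi_ae_eq]
      simp
    · have inv_le : (2 * Real.pi * x)⁻¹ ≤ u := by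
        rw [div_lt_iff₀ hx] at h
        rw [inv_le_iff_one_le_mul₀ (by positivity)]
        calc (1 : ℝ) ≤ 2 * u * x := h.le
          _ ≤ Real.pi * (2 * u * x) :=
            le_mul_of_one_le_left (by positivity) (by linarith [Real.pi_gt_three])
          _ = u * (2 * Real.pi * x) := by ring
      rw [enorm_smul, enorm_smul, ← one_mul B, Real.enorm_of_nonneg (by positivity)]
      gcongr
      · rw [← ofReal_norm]
        exact ENNReal.ofReal_le_one.2 (Real.abs_sin_le_one _)
      · exact tail_le _
  calc ‖remainder γ m θ x‖ₑ ≤ ENNReal.ofReal (2 * u) * B + ENNReal.ofReal u * B := by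
        rw [remainder_eq hθ]
        exact (enorm_sub_le).trans (add_le_add transform_le jump_le)
    _ = ENNReal.ofReal (3 * u) * B := by
        rw [← add_mul, ← ENNReal.ofReal_add (by positivity) hu.le]
        ring_nf

end Remainder

section HighFrequencies

variable {E : Type*} [NormedAddCommGroup E] [NormedSpace ℂ E] {m : Measure ℝ} {θ : ℝ → E}
  {u x : ℝ}

theorem norm_integral_sin_smul_le (hθ : Integrable θ m) (x γ : ℝ) :
    ‖∫ s, Real.sin (2 * Real.pi * (x * s - γ)) • θ s ∂m‖
      ≤ ‖densityFourierInv m θ x‖ + ‖densityFourierInv m θ (-x)‖ := by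
  have integrable_char (ξ a : ℝ) :
      Integrable (fun s => Real.fourierChar a • Real.fourierChar (s * ξ) • θ s) m :=
    (hθ.bdd_smul 1 (φ := fun s => (Real.fourierChar (s * ξ) : ℂ))
      (Continuous.aestronglyMeasurable (by fun_prop))
      (ae_of_all _ fun _ => (Circle.norm_coe _).le)).smul (Real.fourierChar a : ℂ)
  have norm_integral_char (ξ a : ℝ) :
      ‖∫ s, Real.fourierChar a • Real.fourierChar (s * ξ) • θ s ∂m‖
        = ‖densityFourierInv m θ ξ‖ := by
    simp only [Circle.smul_def (Real.fourierChar a), integral_smul]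
    rw [norm_smul, Circle.norm_coe, one_mul, densityFourierInv]
  have sin_smul (s : ℝ) : Real.sin (2 * Real.pi * (x * s - γ)) • θ s
      = (Complex.I / 2) • (Real.fourierChar γ • Real.fourierChar (s * -x) • θ s
        - Real.fourierChar (-γ) • Real.fourierChar (s * x) • θ s) := by
    simp only [Circle.smul_def, smul_smul, ← sub_smul, Real.fourierChar_apply, ← Complex.exp_add]
    rw [← Complex.coe_smul, Complex.ofReal_sin, Complex.sin]
    push_cast
    ring_nf
  have norm_I_half_le_one : ‖Complex.I / 2‖ ≤ 1 := by norm_num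
  simp only [sin_smul]
  rw [integral_smul, integral_sub (integrable_char _ _) (integrable_char _ _), norm_smul,
    ← norm_integral_char x (-γ), ← norm_integral_char (-x) γ, add_comm ‖_‖]
  exact (mul_le_of_le_one_left (norm_nonneg _) norm_I_half_le_one).trans (norm_sub_le _ _)

theorem enorm_remainder_le_of_inv_lt (hu : 0 < u) (hm : ∀ᵐ s ∂m, u < s) (hθ : Integrable θ m)
    (hx : u⁻¹ < x) (γ : ℝ) :
    ‖remainder γ m θ x‖ₑ ≤ ENNReal.ofReal (octaveWeight u x) * ‖densityFourierInv m θ x‖ₑ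
      + ENNReal.ofReal (octaveWeight u (-x)) * ‖densityFourierInv m θ (-x)‖ₑ := by
  have hx0 : 0 < x := (inv_pos.2 hu).trans hx
  have integral_eq : ∫ s, remainderKernel γ x s • θ s ∂m
      = ∫ s, Real.sin (2 * Real.pi * (x * s - γ)) • θ s ∂m := by
    refine integral_congr_ae ?_
    filter_upwards [hm] with s hs
    have hs : s ∈ Ioi (1 / x) := (one_div x ▸ inv_lt_of_inv_lt₀ hu hx : 1 / x < u).trans hs
    rw [remainderKernel, indicator_of_mem hs, trigKernel, add_sub_cancel_right]
  rw [octaveWeight_neg, ← mul_add, remainder, integral_eq, enorm_smul,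
    Real.enorm_of_nonneg (by positivity)]
  gcongr
  · exact inv_two_pi_mul_le_octaveWeight hu hx.le
  · simp only [← ofReal_norm]
    rw [← ENNReal.ofReal_add (norm_nonneg _) (norm_nonneg _)]
    exact ENNReal.ofReal_le_ofReal (norm_integral_sin_smul_le hθ x γ)

end HighFrequencies

theorem setLIntegral_add_comp_neg_le {μ : Measure ℝ} [μ.IsNegInvariant] {F : ℝ → ℝ≥0∞}
    (hF : AEMeasurable F μ) (s : Set ℝ) :
    ∫⁻ x in s, (F x + F (-x)) ∂μ ≤ 2 * ∫⁻ x, F x ∂μ := by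
  calc ∫⁻ x in s, (F x + F (-x)) ∂μ ≤ ∫⁻ x, (F x + F (-x)) ∂μ := setLIntegral_le_lintegral _ _
    _ = ∫⁻ x, F x ∂μ + ∫⁻ x, F x ∂μ := by
        rw [lintegral_add_left' hF, lintegral_neg_eq_self]
    _ = 2 * ∫⁻ x, F x ∂μ := (two_mul _).symm

theorem lintegral_remainder_octave_le {p : ℝ≥0∞} (hp : p ≠ 0) {m : Measure ℝ} [SigmaFinite m]
    {θ : ℝ → ℂ} {u : ℝ} (hu : 0 < u) (hm : ∀ᵐ s ∂m, s ∈ Ioo u (2 * u)) (hθ : Integrable θ m)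
    (γ : ℝ) :
    ∫⁻ x in Ioi 0, ‖remainder γ m θ x‖ₑ
      ≤ 14 * (eLpNorm (octaveWeight u) p volume * starNorm p (m.withDensityᵥ θ)) := by
  set B : ℝ≥0∞ := eLpNorm (octaveWeight u) p volume * starNorm p (m.withDensityᵥ θ)
  have low : ∫⁻ x in Ioc 0 u⁻¹, ‖remainder γ m θ x‖ₑ ≤ 12 * B := by
    calc ∫⁻ x in Ioc 0 u⁻¹, ‖remainder γ m θ x‖ₑ
        ≤ ∫⁻ _ in Ioc 0 u⁻¹, ENNReal.ofReal (3 * u) * (4 * B) :=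
          setLIntegral_mono measurable_const fun x hx => enorm_remainder_le hu hm hθ
            (enorm_setIntegral_Ioi_le hp hu hm hθ) hx.1 γ
      _ = ENNReal.ofReal (3 * u * u⁻¹) * (4 * B) := by
          rw [setLIntegral_const, Real.volume_Ioc, sub_zero, mul_right_comm,
            ← ENNReal.ofReal_mul (by positivity)]
      _ = 12 * B := by
          rw [mul_inv_cancel_right₀ hu.ne', ← mul_assoc]
          norm_num
  have norm_le : ∀ᵐ s ∂m, ‖s‖ ≤ 2 * u := hm.mono fun s hs =>
    (Real.norm_of_nonneg (hu.trans hs.1).le).trans_le hs.2.le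
  have high : ∫⁻ x in Ioi u⁻¹, ‖remainder γ m θ x‖ₑ ≤ 2 * B := by
    refine (setLIntegral_mono' measurableSet_Ioi fun x hx => enorm_remainder_le_of_inv_lt hu
      (hm.mono fun s hs => hs.1) hθ hx γ).trans ((setLIntegral_add_comp_neg_le ?_ _).trans ?_)
    · have := (contDiff_densityFourierInv hθ norm_le).continuous.measurable
      have := (contDiff_octaveWeight u (n := 0)).continuous.measurable
      fun_prop
    · gcongr
      exact lintegral_octaveWeight_mul_densityFourierInv_le hp hθ norm_le hu
  calc ∫⁻ x in Ioi 0, ‖remainder γ m θ x‖ₑ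
      = ∫⁻ x in Ioc 0 u⁻¹ ∪ Ioi u⁻¹, ‖remainder γ m θ x‖ₑ := by
        rw [Ioc_union_Ioi_eq_Ioi (inv_nonneg.2 hu.le)]
    _ ≤ 12 * B + 2 * B := (lintegral_union_le _ _ _).trans (add_le_add low high)
    _ = 14 * B := by rw [← add_mul]; norm_num

section Averaging

theorem integrableOn_inv_Ioo_half {s : ℝ} (hs : 0 < s) :
    IntegrableOn (fun u : ℝ => u⁻¹) (Ioo (s / 2) s) := by
  have continuousOn_inv : ContinuousOn (fun u : ℝ => u⁻¹) (Icc (s / 2) s) :=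
    continuousOn_inv₀.mono fun u hu => ((half_pos hs).trans_le hu.1).ne'
  exact continuousOn_inv.integrableOn_Icc.mono_set Ioo_subset_Icc_self

theorem setIntegral_inv_Ioo_half {s : ℝ} (hs : 0 < s) :
    ∫ u in Ioo (s / 2) s, u⁻¹ = Real.log 2 := by
  rw [← integral_Ioc_eq_integral_Ioo, ← intervalIntegral.integral_of_le (half_le_self hs.le),
    integral_inv_of_pos (half_pos hs) hs, div_div_cancel₀ hs.ne']

variable {E : Type*} [NormedAddCommGroup E] [NormedSpace ℝ E] {m : Measure ℝ} {q : ℝ → E}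

theorem measurableSet_octave : MeasurableSet {z : ℝ × ℝ | z.2 ∈ Ioo z.1 (2 * z.1)} :=
  (measurableSet_lt measurable_fst measurable_snd).inter
    (measurableSet_lt measurable_snd (measurable_fst.const_mul 2))

theorem indicator_octave_eq (u s : ℝ) :
    {z : ℝ × ℝ | z.2 ∈ Ioo z.1 (2 * z.1)}.indicator (fun z => z.1⁻¹ • q z.2) (u, s)
      = (Ioo (s / 2) s).indicator (fun u => u⁻¹) u • q s := by
  have mem_iff : (u, s) ∈ {z : ℝ × ℝ | z.2 ∈ Ioo z.1 (2 * z.1)} ↔ u ∈ Ioo (s / 2) s := by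
    simp only [mem_ofPred_eq, mem_Ioo, div_lt_iff₀' (two_pos : (0 : ℝ) < 2), and_comm]
  by_cases h : u ∈ Ioo (s / 2) s
  · rw [indicator_of_mem (mem_iff.2 h), indicator_of_mem h]
  · rw [indicator_of_notMem (mem_iff.not.2 h), indicator_of_notMem h, zero_smul]

theorem integrable_indicator_octave [SFinite m] (hm : ∀ᵐ s ∂m, 0 < s) (hq : Integrable q m) :
    Integrable ({z : ℝ × ℝ | z.2 ∈ Ioo z.1 (2 * z.1)}.indicator fun z => z.1⁻¹ • q z.2)
      (volume.prod m) := by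
  have aestronglyMeasurable_indicator : AEStronglyMeasurable
      ({z : ℝ × ℝ | z.2 ∈ Ioo z.1 (2 * z.1)}.indicator fun z => z.1⁻¹ • q z.2)
      (volume.prod m) :=
    (measurable_fst.inv.aestronglyMeasurable.smul hq.aestronglyMeasurable.comp_snd).indicator
      measurableSet_octave
  refine (integrable_prod_iff' aestronglyMeasurable_indicator).2 ⟨?_, ?_⟩
  · filter_upwards [hm] with s hs
    simp only [indicator_octave_eq]
    exact ((integrableOn_inv_Ioo_half hs).integrable_indicator measurableSet_Ioo).smul_const (q s)
  · refine (hq.norm.const_mul (Real.log 2)).congr ?_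
    filter_upwards [hm] with s hs
    have indicator_nonneg (u : ℝ) : 0 ≤ (Ioo (s / 2) s).indicator (fun u => u⁻¹) u :=
      Set.indicator_nonneg (fun u hu => inv_nonneg.2 ((half_pos hs).trans hu.1).le) u
    simp only [indicator_octave_eq, norm_smul, Real.norm_of_nonneg (indicator_nonneg _)]
    rw [integral_mul_const, integral_indicator measurableSet_Ioo, setIntegral_inv_Ioo_half hs]

theorem log_two_smul_integral_eq [CompleteSpace E] [SFinite m] (hm : ∀ᵐ s ∂m, 0 < s)
    (hq : Integrable q m) :
    Real.log 2 • ∫ s, q s ∂m = ∫ u, u⁻¹ • ∫ s in Ioo u (2 * u), q s ∂m := by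
  have inner_octave (u : ℝ) :
      ∫ s, {z : ℝ × ℝ | z.2 ∈ Ioo z.1 (2 * z.1)}.indicator (fun z => z.1⁻¹ • q z.2) (u, s) ∂m
        = u⁻¹ • ∫ s in Ioo u (2 * u), q s ∂m := by
    rw [← integral_smul, ← integral_indicator measurableSet_Ioo]
    rfl
  simp only [← inner_octave]
  rw [integral_integral_swap (f := fun u s => {z : ℝ × ℝ | z.2 ∈ Ioo z.1 (2 * z.1)}.indicator
    (fun z => z.1⁻¹ • q z.2) (u, s)) (integrable_indicator_octave hm hq), ← integral_smul]
  refine integral_congr_ae ?_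
  filter_upwards [hm] with s hs
  simp only [indicator_octave_eq]
  rw [integral_smul_const, integral_indicator measurableSet_Ioo, setIntegral_inv_Ioo_half hs]

theorem enorm_integral_le_lintegral_octave [CompleteSpace E] [SFinite m]
    (hm : ∀ᵐ s ∂m, 0 < s) (hq : Integrable q m) :
    ‖∫ s, q s ∂m‖ₑ ≤ ENNReal.ofReal (Real.log 2)⁻¹ *
      ∫⁻ u in Ioi 0, ENNReal.ofReal u⁻¹ * ‖∫ s in Ioo u (2 * u), q s ∂m‖ₑ := by
  have eq_zero_of_nonpos (u : ℝ) (hu : u ∉ Ioi 0) : u⁻¹ • ∫ s in Ioo u (2 * u), q s ∂m = 0 := by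
    have two_mul_le : 2 * u ≤ u := by linarith [notMem_Ioi.1 hu]
    rw [Ioo_eq_empty two_mul_le.not_gt, setIntegral_empty, smul_zero]
  have log_two_pos : 0 < Real.log 2 := Real.log_pos one_lt_two
  calc ‖∫ s, q s ∂m‖ₑ
      = ‖(Real.log 2)⁻¹ • ∫ u in Ioi 0, u⁻¹ • ∫ s in Ioo u (2 * u), q s ∂m‖ₑ := by
        rw [setIntegral_eq_integral_of_forall_compl_eq_zero eq_zero_of_nonpos,
          ← log_two_smul_integral_eq hm hq,
          inv_smul_smul₀ log_two_pos.ne']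
    _ ≤ ENNReal.ofReal (Real.log 2)⁻¹ * ∫⁻ u in Ioi 0, ‖u⁻¹ • ∫ s in Ioo u (2 * u), q s ∂m‖ₑ := by
        rw [enorm_smul, Real.enorm_of_nonneg (by positivity)]
        gcongr
        exact enorm_integral_le_lintegral_enorm _
    _ = _ := by
        congr 1
        refine setLIntegral_congr_fun measurableSet_Ioi fun u hu => ?_
        rw [enorm_smul, Real.enorm_of_nonneg (inv_nonneg.2 (le_of_lt hu))]

end Averaging

section RemainderIntegral

variable {E : Type*} [NormedAddCommGroup E] [NormedSpace ℝ E] {m : Measure ℝ} {θ : ℝ → E}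

@[fun_prop]
theorem measurable_remainderKernel {α : Type*} [MeasurableSpace α] {f g : α → ℝ}
    (hf : Measurable f) (hg : Measurable g) (γ : ℝ) :
    Measurable fun a => remainderKernel γ (f a) (g a) := by
  have measurableSet_jump : MeasurableSet {a | g a ∈ Ioi (1 / f a)} :=
    measurableSet_lt (by fun_prop) hg
  exact (by fun_prop : Measurable fun a => trigKernel γ (f a * g a)).sub
    (measurable_const.indicator measurableSet_jump)

theorem integrable_remainderKernel_smul (hθ : Integrable θ m) (γ x : ℝ) :
    Integrable (fun s => remainderKernel γ x s • θ s) m := by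
  have integrable_jump : Integrable
      (fun s => (Ioi (1 / x)).indicator (fun _ => Real.sin (2 * Real.pi * γ)) s • θ s) m := by
    rw [← indicator_smul_left]
    exact (hθ.smul (Real.sin (2 * Real.pi * γ))).indicator measurableSet_Ioi
  simp only [remainderKernel, sub_smul]
  exact (integrable_trigKernel_smul hθ γ x).sub integrable_jump

theorem aestronglyMeasurable_remainder [SFinite m] (hθ : AEStronglyMeasurable θ m) (γ : ℝ) :
    AEStronglyMeasurable (remainder γ m θ) volume := by
  have prefactor : AEStronglyMeasurable (fun x : ℝ => (2 * Real.pi * x)⁻¹) volume :=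
    Measurable.aestronglyMeasurable (by fun_prop)
  exact prefactor.smul ((measurable_remainderKernel measurable_fst measurable_snd
    γ).aestronglyMeasurable.smul hθ.comp_snd).integral_prod_right'

theorem aestronglyMeasurable_remainder_octave [SFinite m] (hθ : AEStronglyMeasurable θ m)
    (γ : ℝ) :
    AEStronglyMeasurable (fun z : ℝ × ℝ => remainder γ (m.restrict (Ioo z.2 (2 * z.2))) θ z.1)
      (volume.prod volume) := by
  have prefactor : AEStronglyMeasurable (fun z : ℝ × ℝ => (2 * Real.pi * z.1)⁻¹)
      (volume.prod volume) := Measurable.aestronglyMeasurable (by fun_prop)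
  have kernel : Measurable fun w : (ℝ × ℝ) × ℝ => remainderKernel γ w.1.1 w.2 := by fun_prop
  have octave : MeasurableSet {w : (ℝ × ℝ) × ℝ | w.2 ∈ Ioo w.1.2 (2 * w.1.2)} :=
    measurableSet_octave.preimage (by fun_prop : Measurable fun w : (ℝ × ℝ) × ℝ => (w.1.2, w.2))
  have integrand : AEStronglyMeasurable
      ({w : (ℝ × ℝ) × ℝ | w.2 ∈ Ioo w.1.2 (2 * w.1.2)}.indicator
        fun w => remainderKernel γ w.1.1 w.2 • θ w.2) ((volume.prod volume).prod m) :=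
    (kernel.aestronglyMeasurable.smul hθ.comp_snd).indicator octave
  simp only [remainder, ← integral_indicator (measurableSet_Ioo (α := ℝ))]
  exact prefactor.smul integrand.integral_prod_right'

theorem enorm_remainder_le_lintegral_octave [CompleteSpace E] [SFinite m]
    (hm : ∀ᵐ s ∂m, 0 < s) (hθ : Integrable θ m) (γ x : ℝ) :
    ‖remainder γ m θ x‖ₑ ≤ ENNReal.ofReal (Real.log 2)⁻¹ *
      ∫⁻ u in Ioi 0, ENNReal.ofReal u⁻¹ * ‖remainder γ (m.restrict (Ioo u (2 * u))) θ x‖ₑ := by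
  have integrable_integrand :
      Integrable (fun s => (2 * Real.pi * x)⁻¹ • remainderKernel γ x s • θ s) m :=
    (integrable_remainderKernel_smul hθ γ x).smul (2 * Real.pi * x)⁻¹
  simpa only [integral_smul, remainder] using
    enorm_integral_le_lintegral_octave hm integrable_integrand

end RemainderIntegral

theorem lintegral_remainder_le {p : ℝ≥0∞} (hp : 1 < p) {m : Measure ℝ} [SigmaFinite m]
    {θ : ℝ → ℂ} (hm : ∀ᵐ s ∂m, 0 < s) (hθ : Integrable θ m) (γ : ℝ) :
    ∫⁻ x in Ioi 0, ‖remainder γ m θ x‖ₑ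
      ≤ ENNReal.ofReal (Real.log 2)⁻¹ * (14 * eLpNorm (octaveWeight 1) p volume) *
        ∫⁻ u in Ioi 0, ENNReal.ofReal (u ^ (-(p⁻¹).toReal)) *
          starNorm p ((m.withDensityᵥ θ).restrict (Ioo u (2 * u))) := by
  have octave_le (u : ℝ) (hu : u ∈ Ioi 0) : ENNReal.ofReal u⁻¹ *
        ∫⁻ x in Ioi 0, ‖remainder γ (m.restrict (Ioo u (2 * u))) θ x‖ₑ
      ≤ 14 * eLpNorm (octaveWeight 1) p volume * (ENNReal.ofReal (u ^ (-(p⁻¹).toReal)) *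
        starNorm p ((m.withDensityᵥ θ).restrict (Ioo u (2 * u)))) := by
    have power_eq : u⁻¹ * u ^ (1 - (p⁻¹).toReal) = u ^ (-(p⁻¹).toReal) := by
      rw [← Real.rpow_neg_one, ← Real.rpow_add hu]
      ring_nf
    refine (mul_le_mul_right (lintegral_remainder_octave_le (zero_lt_one.trans hp).ne' hu
      (ae_restrict_mem measurableSet_Ioo) hθ.integrableOn γ) _).trans_eq ?_
    rw [withDensityᵥ_restrict hθ measurableSet_Ioo, eLpNorm_octaveWeight p hu, ← power_eq,
      ENNReal.ofReal_mul (inv_nonneg.2 (le_of_lt hu))]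
    ring
  calc ∫⁻ x in Ioi 0, ‖remainder γ m θ x‖ₑ
      ≤ ∫⁻ x in Ioi 0, ENNReal.ofReal (Real.log 2)⁻¹ * ∫⁻ u in Ioi 0,
          ENNReal.ofReal u⁻¹ * ‖remainder γ (m.restrict (Ioo u (2 * u))) θ x‖ₑ :=
        lintegral_mono fun x => enorm_remainder_le_lintegral_octave hm hθ γ x
    _ = ENNReal.ofReal (Real.log 2)⁻¹ * ∫⁻ u in Ioi 0, ENNReal.ofReal u⁻¹ *
          ∫⁻ x in Ioi 0, ‖remainder γ (m.restrict (Ioo u (2 * u))) θ x‖ₑ := by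
        rw [lintegral_const_mul' _ _ ENNReal.ofReal_ne_top, lintegral_lintegral_swap]
        · simp only [lintegral_const_mul' _ _ ENNReal.ofReal_ne_top]
        · rw [Measure.prod_restrict]
          exact (AEMeasurable.mul (by fun_prop)
            (aestronglyMeasurable_remainder_octave hθ.aestronglyMeasurable γ).enorm).restrict
    _ ≤ _ := by
        rw [mul_assoc, ← lintegral_const_mul' _ _ (ENNReal.mul_ne_top (by norm_num)
          (memLp_octaveWeight_one hp).eLpNorm_ne_top)]
        gcongr ENNReal.ofReal (Real.log 2)⁻¹ * ?_
        exact setLIntegral_mono' measurableSet_Ioi octave_le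

theorem bvMeasure_Ioi {f : ℝ → ℂ} (hf : BoundedVariationOn f (Ioi 0))
    (hlim : Tendsto f atTop (𝓝 0)) {t : ℝ} (ht : 0 < t)
    (hc : ContinuousAt ((Ioi 0).indicator f) t) :
    bvMeasure hf (Ioi t) = -f t := by
  have tendsto_indicator : Tendsto ((Ioi 0).indicator f) atTop (𝓝 0) := by
    refine hlim.congr' ?_
    filter_upwards [Ioi_mem_atTop 0] with x hx
    rw [indicator_of_mem hx]
  rw [bvMeasure, VectorMeasure.restrict_apply _ measurableSet_Ioi measurableSet_Ioi,
    inter_eq_self_of_subset_left (Ioi_subset_Ioi ht.le), BoundedVariationOn.vectorMeasure_Ioi,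
    tendsto_indicator.limUnder_eq,
    rightLim_eq_of_tendsto (hc.tendsto.mono_left nhdsWithin_le_nhds),
    indicator_of_mem (mem_Ioi.2 ht), zero_sub]

theorem ae_eq_neg_setIntegral_Ioi {f : ℝ → ℂ} (hf : BoundedVariationOn f (Ioi 0))
    (hlim : Tendsto f atTop (𝓝 0)) {m : Measure ℝ} {θ : ℝ → ℂ} (hθ : Integrable θ m)
    (withDensityᵥ_eq : m.withDensityᵥ θ = bvMeasure hf) :
    ∀ᵐ t : ℝ, 0 < t → f t = -∫ s in Ioi t, θ s ∂m := by
  filter_upwards [hf.indicator_Ioi_zero.locallyBoundedVariationOn.ae_differentiableWithinAt_of_mem]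
    with t differentiableWithinAt ht
  have continuousAt : ContinuousAt ((Ioi 0).indicator f) t :=
    (differentiableWithinAt_univ.1 (differentiableWithinAt (mem_univ t))).continuousAt
  rw [← withDensityᵥ_apply hθ measurableSet_Ioi, withDensityᵥ_eq,
    bvMeasure_Ioi hf hlim ht continuousAt, neg_neg]

theorem ae_one_div_of_ae {P : ℝ → Prop} (h : ∀ᵐ t : ℝ, 0 < t → P t) :
    ∀ᵐ x : ℝ, 0 < x → P (1 / x) := by
  have image_null : volume (Inv.inv '' {t : ℝ | 0 < t ∧ ¬P t}) = 0 := by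
    refine addHaar_image_eq_zero_of_differentiableOn_of_addHaar_eq_zero _
      (fun t ht => (differentiableAt_inv ht.1.ne').differentiableWithinAt) ?_
    simpa only [ae_iff, Classical.not_imp] using h
  refine measure_mono_null (fun x hx => ?_) image_null
  obtain ⟨hx0, hPx⟩ := Classical.not_imp.1 hx
  exact ⟨1 / x, ⟨one_div_pos.2 hx0, hPx⟩, by simp⟩

theorem isTrigTransform_neg_tailTransform {m : Measure ℝ} [SFinite m] {θ : ℝ → ℂ}
    (hm : ∀ᵐ s ∂m, 0 < s) (hθ : Integrable θ m) {f : ℝ → ℂ}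
    (hf : ∀ᵐ t : ℝ, 0 < t → f t = -∫ s in Ioi t, θ s ∂m) (γ : ℝ) :
    IsTrigTransform γ f fun x => -tailTransform γ m θ x := by
  have integrand_ae_eq (x R : ℝ) :
      (fun t => f t * (Real.cos (2 * Real.pi * (x * t - γ)) : ℂ))
        =ᵐ[volume.restrict (Ioc 0 R)]
      fun t => -(Real.cos (2 * Real.pi * (x * t - γ)) • ∫ s in Ioi t, θ s ∂m) := by
    filter_upwards [ae_restrict_of_ae hf, ae_restrict_mem measurableSet_Ioc] with t hft ht
    rw [hft ht.1, Complex.real_smul, neg_mul, mul_comm]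
  refine fun x hx => ⟨fun R _ => ?_, ?_⟩
  · exact (integrableOn_cos_smul_setIntegral_Ioi hθ x γ R).neg.congr (integrand_ae_eq x R).symm
  · simpa only [integral_congr_ae (integrand_ae_eq x _), integral_neg] using
      (tendsto_setIntegral_cos_smul_setIntegral_Ioi hm hθ hx.ne' γ).neg

theorem neg_tailTransform_sub_ae_eq {m : Measure ℝ} {θ : ℝ → ℂ} (hθ : Integrable θ m)
    {f : ℝ → ℂ} (hf : ∀ᵐ t : ℝ, 0 < t → f t = -∫ s in Ioi t, θ s ∂m) (γ : ℝ) :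
    (fun x => -tailTransform γ m θ x
        - (1 / (2 * Real.pi * x) : ℝ) * f (1 / x) * (Real.sin (2 * Real.pi * γ) : ℝ))
      =ᵐ[volume.restrict (Ioi 0)] fun x => -remainder γ m θ x := by
  filter_upwards [ae_restrict_of_ae (ae_one_div_of_ae hf), ae_restrict_mem measurableSet_Ioi]
    with x hfx hx
  rw [hfx hx, remainder_eq hθ, Complex.real_smul, Complex.real_smul, one_div (2 * Real.pi * x)]
  ring

theorem mainTheorem1_general (p : ℝ≥0∞) (hp : 1 < p) :
    ∃ C : ℝ≥0, ∀ (f : ℝ → ℂ) (hf : BoundedVariationOn f (Ioi 0)),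
      Tendsto f atTop (𝓝 0) → vStarNorm p hf < ∞ →
      ∀ γ : ℝ,
        ∃ F Γ : ℝ → ℂ, IsTrigTransform γ f F ∧
          (∀ x : ℝ, 0 < x →
            F x = (1 / (2 * Real.pi * x) : ℝ) * f (1 / x) * (Real.sin (2 * Real.pi * γ) : ℝ)
              + Γ x) ∧
          IntegrableOn Γ (Ioi 0) volume ∧
          eLpNorm Γ 1 (volume.restrict (Ioi 0)) ≤ C * vStarNorm p hf := by
  obtain ⟨C, C_eq⟩ : ∃ C : ℝ≥0,
      C = ENNReal.ofReal (Real.log 2)⁻¹ * (14 * eLpNorm (octaveWeight 1) p volume) :=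
    WithTop.ne_top_iff_exists.1 (ENNReal.mul_ne_top ENNReal.ofReal_ne_top
      (ENNReal.mul_ne_top (by norm_num) (memLp_octaveWeight_one hp).eLpNorm_ne_top))
  refine ⟨C, fun f hf hlim hV γ => ?_⟩
  obtain ⟨m, θ, _, hm, hθ, withDensityᵥ_eq⟩ := exists_withDensityᵥ_eq_restrict
    hf.indicator_Ioi_zero.vectorMeasure (measurableSet_Ioi (a := (0 : ℝ)))
  have f_eq_tail := ae_eq_neg_setIntegral_Ioi hf hlim hθ withDensityᵥ_eq
  have Γ_eq := neg_tailTransform_sub_ae_eq hθ f_eq_tail γ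
  have Γ_norm_le : eLpNorm (fun x => -remainder γ m θ x) 1 (volume.restrict (Ioi 0))
      ≤ C * vStarNorm p hf := by
    simp only [eLpNorm_one_eq_lintegral_enorm, enorm_neg]
    rw [C_eq, vStarNorm, bvMeasure, ← withDensityᵥ_eq]
    exact lintegral_remainder_le hp hm hθ γ
  have Γ_memLp : MemLp (fun x => -remainder γ m θ x) 1 (volume.restrict (Ioi 0)) :=
    ⟨(aestronglyMeasurable_remainder hθ.aestronglyMeasurable γ).neg.restrict,
      Γ_norm_le.trans_lt (ENNReal.mul_lt_top ENNReal.coe_lt_top hV)⟩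
  exact ⟨_, _, isTrigTransform_neg_tailTransform hm hθ f_eq_tail γ,
    fun x _ => (add_sub_cancel _ _).symm, (memLp_one_iff_integrable.1 Γ_memLp).congr Γ_eq.symm,
    (eLpNorm_congr_ae Γ_eq).trans_le Γ_norm_le⟩

theorem mainTheorem1 (p : ℝ≥0∞) (hp : 1 < p) :
    ∃ C : ℝ≥0, ∀ (f : ℝ → ℂ) (hf : BoundedVariationOn f (Ioi 0)),
      Tendsto f atTop (𝓝 0) → vStarNorm p hf < ∞ →
      ∀ γ : ℝ, γ = 0 ∨ γ = 1 / 4 →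
        ∃ F Γ : ℝ → ℂ, IsTrigTransform γ f F ∧
          (∀ x : ℝ, 0 < x →
            F x = (1 / (2 * Real.pi * x) : ℝ) * f (1 / x) * (Real.sin (2 * Real.pi * γ) : ℝ)
              + Γ x) ∧
          IntegrableOn Γ (Ioi 0) volume ∧
          eLpNorm Γ 1 (volume.restrict (Ioi 0)) ≤ C * vStarNorm p hf := by
  obtain ⟨C, hC⟩ := mainTheorem1_general p hp
  exact ⟨C, fun f hf hlim hV γ _ => hC f hf hlim hV γ⟩
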